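/- **Notation.** Let $n\ge 1$, $\mathrm b_n=\frac{n(n-1)}2$, $2\rho_n=(n-1,n-3,\dots,1-n)$, $\varepsilon\in\{\pm1\}$ and $\psi_\varepsilon(z)=\exp(2\pi\varepsilon\sqrt{-1}(z+\bar z))$ on $\mathbf C$. Let $\Lambda_n=\{\lambda\in\mathbf Z^n\mid\lambda_1\ge\dots\ge\lambda_n\}$. For $\lambda\in\Lambda_n$ and $l\in\mathbf Z$ write $\lambda^\vee=(-\lambda_n,\dots,-\lambda_1)$ and $\lambda+l=(\lambda_1+l,\dots,\lambda_n+l)$. *Finite-dimensional representations.* $V_\lambda\subset\mathbf C[z,(\det z)^{-1}]$ ($z=(z_{i,j})_{1\le i,j\le n}$) is the span of the products $\prod_I(\det_I z)^{l_I}$, where $I$ runs through the nonempty subsets of $\{1,\dots,n\}$, $\det_I$ is the minor with rows $1,\dots,\#I$ and columns $I$, $l_{\{1,\dots,n\}}=\lambda_n$, $l_I\ge0$ for $I\neq\{1,\dots,n\}$, and $\sum_{\#I=k}l_I=\lambda_k-\lambda_{k+1}$ for $1\le k<n$. The group $\mathrm{GL}_n(\mathbf C)$ acts by $(\tau_\lambda(g)f)(z)=f(zg)$.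 Let $v_\lambda=(\det z)^{\lambda_n}\prod_{k<n}(\det_{\{1,\dots,k\}}z)^{\lambda_k-\lambda_{k+1}}$, a highest weight vector, and fix the $\mathrm U(n)$-invariant hermitian inner product on $V_\lambda$ with $(v_\lambda,v_\lambda)=1$. Let $\mathrm G(\lambda)$ be the set of Gel'fand–Tsetlin patterns $M=(m_{i,j})_{1\le i\le j\le n}$ of type $\lambda$ (so $m_{i,n}=\lambda_i$), and $(\zeta_M)_{M\in\mathrm G(\lambda)}$ the Gel'fand–Tsetlin orthonormal basis of $V_\lambda$ in which $\zeta_M=v_\lambda$ for the pattern $M=(\lambda_i)_{i\le j}$. That is, $E_{k,k}\zeta_M=\bigl(\sum_{i\le k}m_{i,k}-\sum_{i\le k-1}m_{i,k-1}\bigr)\zeta_M$, $E_{j,j+1}\zeta_M=\sum_{i\le j}\mathrm a_{i,j}(M)\zeta_{M+\Delta_{i,j}}$ and $E_{j+1,j}\zeta_M=\sum_{i\le j}\mathrm a_{i,j}(M^\vee)\zeta_{M+\Delta_{i,j}^\vee}$, the sums running over those $i$ for which the index lies in $\mathrm G(\lambda)$. Here $M^\vee=(-m_{j+1-i,j})_{i,j}$,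 $\Delta_{i,j}$ is the array with single nonzero entry $1$ at $(i,j)$, and $$\mathrm a_{i,j}(M)=\left|\frac{\prod_{h=1}^{j+1}(m_{h,j+1}-m_{i,j}-h+i)\prod_{h=1}^{j-1}(m_{h,j-1}-m_{i,j}-h+i-1)}{\prod_{1\le h\le j,\,h\ne i}(m_{h,j}-m_{i,j}-h+i)(m_{h,j}-m_{i,j}-h+i-1)}\right|^{1/2}.$$ Put $\mathrm q(M)=\sum_{1\le i\le j\le n-1}m_{i,j}$ and $\xi_M=\sqrt{\mathrm r(M)}\,\zeta_M$ with $$\mathrm r(M)=\prod_{1\le i\le j<k\le n}\frac{(m_{i,k}-m_{j,k-1}-i+j)!\,(m_{i,k-1}-m_{j+1,k}-i+j)!}{(m_{i,k-1}-m_{j,k-1}-i+j)!\,(m_{i,k}-m_{j+1,k}-i+j)!}.$$ *Maps.* $V^{\mathrm{conj}}_\lambda$ is the space $V_\lambda$ with $g$ acting by $\tau_\lambda(\bar g)$; $\mathrm I^{\mathrm{conj}}_\lambda\colon V_\lambda\to V^{\mathrm{conj}}_{\lambda^\vee}$ is the linear map with $\xi_M\mapsto(-1)^{\mathrm q(M)}\xi_{M^\vee}$.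 $\mathrm I^{\lambda,\lambda'}_{\lambda+\lambda'}\colon V_{\lambda+\lambda'}\to V_\lambda\otimes V_{\lambda'}$ is the unique $\mathrm{GL}_n(\mathbf C)$-equivariant injection with $v_{\lambda+\lambda'}\mapsto v_\lambda\otimes v_{\lambda'}$. $\mathrm I^{\det}_{\lambda,l}\colon V_\lambda\to V_{\lambda-l}$ is $v\mapsto(\det z)^{-l}v$. Let $\mathfrak p^0_n$ be the real space of trace-zero hermitian $n\times n$ matrices, $\mathfrak p^{0\vee}_{n\mathbf C}$ the dual of $\mathfrak p^0_n\otimes_{\mathbf R}\mathbf C$ with the contragredient of the adjoint action of $\mathrm U(n)$, and $E^\vee_{i,j}\in\mathfrak p^{0\vee}_{n\mathbf C}$ ($i\neq j$) the functional $X\otimes c\mapsto cX_{i,j}$. $\mathrm I^{\mathfrak p_n}_{2\rho_n}\colon V_{2\rho_n}\to\bigwedge^{\mathrm b_n}\mathfrak p^{0\vee}_{n\mathbf C}$ is the unique $\mathrm U(n)$-equivariant linear map with $v_{2\rho_n}\mapsto E^\vee_{2,1}\wedge E^\vee_{3,1}\wedge E^\vee_{3,2}\wedge\dots\wedge E^\vee_{n,1}\wedge\dots\wedge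 E^\vee_{n,n-1}$. *Whittaker functions.* Let $\mathrm N_n$ be the group of upper triangular unipotent matrices. For $d\in\mathbf Z^n$ and $\nu\in\mathbf C^n$ let $I^\infty(d,\nu)$ be the space of $f\in C^\infty(\mathrm{GL}_n(\mathbf C))$ with $f(xag)=\prod_i(a_i/|a_i|)^{d_i}|a_i|^{2\nu_i+n+1-2i}f(g)$ for $x\in\mathrm N_n(\mathbf C)$, $a=\mathrm{diag}(a_1,\dots,a_n)$ and $g\in\mathrm{GL}_n(\mathbf C)$, on which $\mathrm{GL}_n(\mathbf C)$ acts by right translation; call this representation $\pi_{\mathrm B_n,d,\nu}$. Let $\mathcal J_\varepsilon\colon I^\infty(d,\nu)\to\mathbf C$ be the linear form given, for $\mathrm{Re}\,\nu_1>\dots>\mathrm{Re}\,\nu_n$, by $$\mathcal J_\varepsilon(f)=\int_{\mathrm N_n(\mathbf C)}f(w_nx)\,\psi_{-\varepsilon}(x_{1,2}+\dots+x_{n-1,n})\,dx,$$ where $w_n$ is the antidiagonal permutation matrix and $dx$ is the product over $i<j$ of twice the Lebesgue measures in $x_{i,j}\in\mathbf C$, and extended to all $\nu\in\mathbf C^n$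 by holomorphic continuation along the standard sections (families $F_\nu\in I^\infty(d,\nu)$ with $F_\nu|_{\mathrm U(n)}$ independent of $\nu$). Put $\mathrm W_\varepsilon(f)(g)=\mathcal J_\varepsilon(\pi_{\mathrm B_n,d,\nu}(g)f)$ and $\mathcal W(\pi_{\mathrm B_n,d,\nu},\psi_\varepsilon)=\{\mathrm W_\varepsilon(f)\mid f\in I^\infty(d,\nu)\}$. For $d\in\Lambda_n$ let $\mathrm f_{d,\nu}\colon V_d\to I^\infty(d,\nu)$ be the $\mathrm U(n)$-equivariant linear embedding with $\mathrm f_{d,\nu}(v_d)(1_n)=1$, and define $\mathbf W^{(\varepsilon)}_{d,\nu}\colon V_d\to\mathcal W(\pi_{\mathrm B_n,d,\nu},\psi_\varepsilon)$ by $$\mathbf W^{(\varepsilon)}_{d,\nu}(v)=(-\varepsilon\sqrt{-1})^{\sum_i(i-1)d_i}\prod_{i<j}\Gamma\bigl(\nu_i-\nu_j+1+\tfrac{|d_i-d_j|}2\bigr)\,\mathrm W_\varepsilon(\mathrm f_{d,\nu}(v)).$$ *The generator.* Let $\lambda\in\Lambda_n$, $\mathsf w\in\mathbf Z$ and $d=2\lambda+2\rho_n-\mathsf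 w$; a subscript $\mathsf w/2$ means $\nu=(\mathsf w/2,\dots,\mathsf w/2)$. Then $[\pi_{\mathrm B_n,d,\mathsf w/2}]_\varepsilon\in\mathcal W(\pi_{\mathrm B_n,d,\mathsf w/2},\psi_\varepsilon)\otimes\bigwedge^{\mathrm b_n}\mathfrak p^{0\vee}_{n\mathbf C}\otimes V_{\lambda^\vee}\otimes V^{\mathrm{conj}}_{\lambda-\mathsf w}$ is the image of $$(\varepsilon\sqrt{-1})^{\mathrm b_n\mathsf w}\sum_{M\in\mathrm G(d)}\frac{(-1)^{\mathrm q(M)}}{\mathrm r(M)}\,\xi_M\otimes\xi_{M^\vee}\in V_d\otimes V_{d^\vee}$$ under the composite $(\mathbf W^{(\varepsilon)}_{d,\mathsf w/2}\otimes\mathrm I^{\mathfrak p_n}_{2\rho_n}\otimes\mathrm{id}\otimes\mathrm I^{\mathrm{conj}}_{\lambda^\vee+\mathsf w})\circ(\mathrm{id}\otimes\mathrm{id}\otimes\mathrm I^{\lambda^\vee,\lambda^\vee+\mathsf w}_{2\lambda^\vee+\mathsf w})\circ(\mathrm{id}\otimes\mathrm I^{2\rho_n,2\lambda^\vee+\mathsf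 w}_{d^\vee})$. **Proposition 2.8.** Let $n\ge1$, $\varepsilon\in\{\pm1\}$, $\lambda\in\Lambda_n$, $\mathsf w\in\mathbf Z$ and $d=2\lambda+2\rho_n-\mathsf w$. For $a,b\in\mathbf Z$ let $\kappa_{a,b}(z)=z^a\bar z^b$ on $\mathbf C^\times$. Then $w\mapsto[g\mapsto w(g)\,\kappa_{a,b}(\det g)]$ defines a linear map $$W_{\kappa_{a,b}}\colon\mathcal W(\pi_{\mathrm B_n,d,\mathsf w/2},\psi_\varepsilon)\to\mathcal W(\pi_{\mathrm B_n,d+a-b,(\mathsf w+a+b)/2},\psi_\varepsilon),$$ and $$\bigl(W_{\kappa_{a,b}}\otimes\mathrm{id}_{\bigwedge^{\mathrm b_n}\mathfrak p^{0\vee}_{n\mathbf C}}\otimes\mathrm I^{\det}_{\lambda^\vee,a}\otimes\mathrm I^{\det}_{\lambda-\mathsf w,b}\bigr)\bigl([\pi_{\mathrm B_n,d,\mathsf w/2}]_\varepsilon\bigr)=[\pi_{\mathrm B_n,d+a-b,(\mathsf w+a+b)/2}]_\varepsilon,$$ where the right-hand side is the generator attached to the weight $\lambda+a$ and the integer $\mathsf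 w+a+b$. -/

import Mathlib

open Matrix
open scoped TensorProduct

namespace CohGen

noncomputable section

variable {n : ℕ}

theorem card_le (I : Finset (Fin n)) : I.card ≤ n := by
  simpa using Finset.card_le_univ I

/-- For `I = {i_1 < … < i_k} ⊆ {1, …, n}`, the minor `det_I(g)` of `g` with rows `1, …, k` and
columns `i_1, …, i_k`. -/
def minor (I : Finset (Fin n)) (g : GL (Fin n) ℂ) : ℂ :=
  ((g : Matrix (Fin n) (Fin n) ℂ).submatrix (Fin.castLE (card_le I))
    (I.orderEmbOfFin rfl)).det

/-- Right translation `(R(g) f)(z) = f(z g)` on functions on `GL_n(ℂ)`. -/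
def rightTranslate (g : GL (Fin n) ℂ) : (GL (Fin n) ℂ → ℂ) →ₗ[ℂ] (GL (Fin n) ℂ → ℂ) where
  toFun f := fun h => f (h * g)
  map_add' _ _ := rfl
  map_smul' _ _ := rfl

theorem rightTranslate_apply (g : GL (Fin n) ℂ) (f : GL (Fin n) ℂ → ℂ) (h : GL (Fin n) ℂ) :
    rightTranslate g f h = f (h * g) := rfl

theorem rightTranslate_mul_fun (g : GL (Fin n) ℂ) (f f' : GL (Fin n) ℂ → ℂ) :
    rightTranslate g (f * f') = rightTranslate g f * rightTranslate g f' := rfl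

/-- Auxiliary: the span of the minors `det_J` with `#J = k`. -/
def minorSpace (n k : ℕ) : Submodule ℂ (GL (Fin n) ℂ → ℂ) :=
  Submodule.span ℂ (minor '' {J : Finset (Fin n) | J.card = k})

theorem det_submatrix_mem (k : ℕ) (hk : k ≤ n) (φ : Fin k → Fin n) :
    (fun z : GL (Fin n) ℂ => ((z : Matrix (Fin n) (Fin n) ℂ).submatrix (Fin.castLE hk) φ).det)
      ∈ minorSpace n k := by
  by_cases hφ : Function.Injective φ
  · obtain ⟨J, hJ⟩ : ∃ J : Finset (Fin n), J = Finset.univ.image φ := ⟨_, rfl⟩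
    have hc : J.card = k := by
      rw [hJ, Finset.card_image_of_injective _ hφ, Finset.card_univ, Fintype.card_fin]
    subst hc
    have hmem : ∀ c, φ c ∈ J := fun c => by rw [hJ]; exact Finset.mem_image_of_mem _ (Finset.mem_univ c)
    let σ : Fin J.card → Fin J.card := fun c => (J.orderIsoOfFin rfl).symm ⟨φ c, hmem c⟩
    have hσ : ∀ c, J.orderEmbOfFin rfl (σ c) = φ c := fun c => by
      simp [σ, Finset.orderEmbOfFin]
    have hinj : Function.Injective σ := fun a b h => hφ (by rw [← hσ a, ← hσ b, h])
    let π : Equiv.Perm (Fin J.card) := Equiv.ofBijective σ (Finite.injective_iff_bijective.mp hinj)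
    have key : (fun z : GL (Fin n) ℂ =>
        ((z : Matrix (Fin n) (Fin n) ℂ).submatrix (Fin.castLE hk) φ).det)
        = (((Equiv.Perm.sign π : ℤˣ) : ℤ) : ℂ) • minor J := by
      funext z
      have := Matrix.det_permute' π ((z : Matrix (Fin n) (Fin n) ℂ).submatrix
        (Fin.castLE (card_le J)) (J.orderEmbOfFin rfl))
      simp only [Pi.smul_apply, smul_eq_mul, minor]
      rw [← this]
      congr 1
      ext i j
      simp [π, hσ]
    rw [key]
    exact Submodule.smul_mem _ _ (Submodule.subset_span ⟨J, rfl, rfl⟩)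
  · have : (fun z : GL (Fin n) ℂ =>
        ((z : Matrix (Fin n) (Fin n) ℂ).submatrix (Fin.castLE hk) φ).det) = 0 := by
      funext z
      simp only [Function.Injective, not_forall] at hφ
      obtain ⟨a, b, h, hab⟩ := hφ
      exact Matrix.det_zero_of_column_eq hab (fun i => by simp [h])
    rw [this]
    exact Submodule.zero_mem _

theorem rightTranslate_minor (g : GL (Fin n) ℂ) (I : Finset (Fin n)) :
    rightTranslate g (minor I) ∈ minorSpace n I.card := by
  have key : rightTranslate g (minor I) = ∑ φ : Fin I.card → Fin n,
      (∏ c, (g : Matrix (Fin n) (Fin n) ℂ) (φ c) (I.orderEmbOfFin rfl c)) •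
      (fun z : GL (Fin n) ℂ =>
        ((z : Matrix (Fin n) (Fin n) ℂ).submatrix (Fin.castLE (card_le I)) φ).det) := by
    funext z
    simp only [rightTranslate_apply, Finset.sum_apply, Pi.smul_apply, smul_eq_mul, minor]
    rw [← Matrix.det_transpose]
    have : (((z * g : GL (Fin n) ℂ) : Matrix (Fin n) (Fin n) ℂ).submatrix
        (Fin.castLE (card_le I)) (I.orderEmbOfFin rfl))ᵀ
        = fun c => ∑ j : Fin n, (g : Matrix (Fin n) (Fin n) ℂ) j (I.orderEmbOfFin rfl c) •
          (fun r => (z : Matrix (Fin n) (Fin n) ℂ) (Fin.castLE (card_le I) r) j) := by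
      ext c r
      simp [Matrix.mul_apply, mul_comm]
    rw [this]
    change Matrix.detRowAlternating _ = _
    rw [← AlternatingMap.coe_multilinearMap, MultilinearMap.map_sum]
    refine Finset.sum_congr rfl fun φ _ => ?_
    rw [MultilinearMap.map_smul_univ, smul_eq_mul]
    congr 1
    rw [← Matrix.det_transpose]
    rfl
  rw [key]
  exact Submodule.sum_mem _ fun φ _ => Submodule.smul_mem _ _ (det_submatrix_mem _ _ φ)


/-- The set `Λ_n` of dominant integral weights `λ_1 ≥ λ_2 ≥ … ≥ λ_n`. -/
@[ext] structure DomWeight (n : ℕ) where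
  toFun : Fin n → ℤ
  anti : Antitone toFun

instance : CoeFun (DomWeight n) (fun _ => Fin n → ℤ) := ⟨DomWeight.toFun⟩

/-- The entry `λ_i`, with `i` counted from `1` (and `0` outside the range `1 ≤ i ≤ n`). -/
def DomWeight.entry (wt : DomWeight n) (i : ℕ) : ℤ :=
  if h : 1 ≤ i ∧ i ≤ n then wt ⟨i - 1, by omega⟩ else 0

/-- The nonempty proper subsets of `{1, …, n}`. -/
def properSubsets (n : ℕ) : Finset (Finset (Fin n)) :=
  Finset.univ.filter fun I => 0 < I.card ∧ I.card < n

/-- `l ∈ 𝓛(λ)`: the exponents `l_I ≥ 0`, for `I` a nonempty proper subset, satisfy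
`∑_{#I = k} l_I = λ_k - λ_{k+1}` for `1 ≤ k ≤ n - 1`. The remaining exponent `l_{{1,…,n}} = λ_n`, which
may be negative, is built into `detGen`; the values of `l` at `∅` and `{1, …, n}` are not used. -/
def IsExponent (wt : DomWeight n) (l : Finset (Fin n) → ℕ) : Prop :=
  ∀ k : ℕ, 1 ≤ k → k < n →
    ((∑ I ∈ Finset.univ.filter (fun I : Finset (Fin n) => I.card = k), l I : ℕ) : ℤ)
      = wt.entry k - wt.entry (k + 1)

/-- The generator `f_l(z) = (det z)^{λ_n} ∏_I (det_I z)^{l_I}`. -/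
def detGen (wt : DomWeight n) (l : Finset (Fin n) → ℕ) : GL (Fin n) ℂ → ℂ := fun g =>
  (g : Matrix (Fin n) (Fin n) ℂ).det ^ (wt.entry n) * ∏ I ∈ properSubsets n, minor I g ^ l I

/-- `V_λ`: the span of the `f_l`, `l ∈ 𝓛(λ)`. Elements of `ℂ[z, (det z)⁻¹]` are regarded as functions on
`GL_n(ℂ)`. -/
def Vrep (wt : DomWeight n) : Submodule ℂ (GL (Fin n) ℂ → ℂ) :=
  Submodule.span ℂ {f | ∃ l, IsExponent wt l ∧ f = detGen wt l}

/-- Auxiliary: the span of the monomials in minors of prescribed degrees. -/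
def minorMonomials (n : ℕ) (m : ℕ → ℕ) : Submodule ℂ (GL (Fin n) ℂ → ℂ) :=
  Submodule.span ℂ {f | ∃ l : Finset (Fin n) → ℕ,
    (∀ k : ℕ, 1 ≤ k → k < n →
      ∑ I ∈ Finset.univ.filter (fun I : Finset (Fin n) => I.card = k), l I = m k) ∧
    f = ∏ I ∈ properSubsets n, minor I ^ l I}

theorem minorMonomials_mul (m : ℕ → ℕ) (k : ℕ) (hk : 1 ≤ k) (hkn : k < n)
    {A B : GL (Fin n) ℂ → ℂ} (hA : A ∈ minorMonomials n m) (hB : B ∈ minorSpace n k) :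
    A * B ∈ minorMonomials n (m + Pi.single k 1) := by
  induction hB using Submodule.span_induction with
  | zero => simp
  | add x y _ _ hx hy => rw [mul_add]; exact Submodule.add_mem _ hx hy
  | smul a x _ hx => rw [mul_smul_comm]; exact Submodule.smul_mem _ _ hx
  | mem x hx =>
    obtain ⟨J, hJ, rfl⟩ := hx
    replace hJ : J.card = k := hJ
    induction hA using Submodule.span_induction with
    | zero => simp
    | add x y _ _ hx hy => rw [add_mul]; exact Submodule.add_mem _ hx hy
    | smul a x _ hx => rw [smul_mul_assoc]; exact Submodule.smul_mem _ _ hx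
    | mem x hx =>
      obtain ⟨l, hl, rfl⟩ := hx
      refine Submodule.subset_span ⟨l + Pi.single J 1, ?_, ?_⟩
      · intro k' h1 h2
        simp only [Pi.add_apply, Finset.sum_add_distrib, hl k' h1 h2]
        congr 1
        simp [Pi.single_apply, hJ, eq_comm]
      · have hJm : J ∈ properSubsets n := by
          simp only [properSubsets, Finset.mem_filter, Finset.mem_univ, true_and]; omega
        simp only [Pi.add_apply, pow_add, Finset.prod_mul_distrib]
        congr 1
        rw [Finset.prod_eq_single J]
        · simp
        · intro b _ hb; simp [hb]
        · intro h; exact absurd hJm h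

theorem minorMonomials_mul_pow (m : ℕ → ℕ) (k : ℕ) (hk : 1 ≤ k) (hkn : k < n)
    {A B : GL (Fin n) ℂ → ℂ} (hA : A ∈ minorMonomials n m) (hB : B ∈ minorSpace n k) (e : ℕ) :
    A * B ^ e ∈ minorMonomials n (m + Pi.single k e) := by
  induction e with
  | zero => simpa using hA
  | succ e ih =>
    have := minorMonomials_mul _ k hk hkn ih hB
    rw [pow_succ, ← mul_assoc, Pi.single_add, ← add_assoc]
    exact this

theorem rightTranslate_prod_mem (g : GL (Fin n) ℂ) (l : Finset (Fin n) → ℕ)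
    (s : Finset (Finset (Fin n))) (hs : s ⊆ properSubsets n) :
    rightTranslate g (∏ I ∈ s, minor I ^ l I)
      ∈ minorMonomials n (∑ I ∈ s, Pi.single I.card (l I)) := by
  classical
  induction s using Finset.induction_on with
  | empty =>
    refine Submodule.subset_span ⟨0, by simp, ?_⟩
    funext z; simp [rightTranslate_apply]
  | insert J s hJ ih =>
    have h1 := hs (Finset.mem_insert_self J s)
    simp only [properSubsets, Finset.mem_filter, Finset.mem_univ, true_and] at h1
    rw [Finset.prod_insert hJ, Finset.sum_insert hJ, mul_comm, rightTranslate_mul_fun, add_comm]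
    exact minorMonomials_mul_pow _ _ h1.1 h1.2
      (ih fun x hx => hs (Finset.mem_insert_of_mem hx)) (rightTranslate_minor g J) (l J)

theorem rightTranslate_mem_Vrep (wt : DomWeight n) (g : GL (Fin n) ℂ)
    {f : GL (Fin n) ℂ → ℂ} (hf : f ∈ Vrep wt) : rightTranslate g f ∈ Vrep wt := by
  induction hf using Submodule.span_induction with
  | zero => simp
  | add x y _ _ hx hy => rw [map_add]; exact Submodule.add_mem _ hx hy
  | smul a x _ hx => rw [map_smul]; exact Submodule.smul_mem _ _ hx
  | mem x hx =>
    obtain ⟨l, hl, rfl⟩ := hx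
    have h1 := rightTranslate_prod_mem g l _ (Finset.Subset.refl (properSubsets n))
    obtain ⟨m, hm⟩ : ∃ m : ℕ → ℕ, m = ∑ I ∈ properSubsets n, Pi.single I.card (l I) := ⟨_, rfl⟩
    rw [← hm] at h1
    have hm' : ∀ k : ℕ, 1 ≤ k → k < n → (m k : ℤ) = wt.entry k - wt.entry (k + 1) := by
      intro k hk hkn
      rw [← hl k hk hkn, hm]
      congr 1
      simp only [Finset.sum_apply, Pi.single_apply, ← Finset.sum_filter, properSubsets,
        Finset.filter_filter]
      refine Finset.sum_congr ?_ fun _ _ => rfl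
      ext I
      simp only [Finset.mem_filter, Finset.mem_univ, true_and]
      omega
    let D : GL (Fin n) ℂ → ℂ := fun z => (z : Matrix (Fin n) (Fin n) ℂ).det ^ (wt.entry n)
    have h2 : rightTranslate g (detGen wt l)
        = ((g : Matrix (Fin n) (Fin n) ℂ).det ^ (wt.entry n)) •
          (D * rightTranslate g (∏ I ∈ properSubsets n, minor I ^ l I)) := by
      funext z
      simp only [rightTranslate_apply, detGen, Pi.smul_apply, Pi.mul_apply, smul_eq_mul, D,
        Finset.prod_apply, Pi.pow_apply, Units.val_mul, Matrix.det_mul, mul_zpow]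
      ring
    rw [h2]
    refine Submodule.smul_mem _ _ ?_
    generalize rightTranslate g (∏ I ∈ properSubsets n, minor I ^ l I) = A at h1
    induction h1 using Submodule.span_induction with
    | zero => simp
    | add x y _ _ hx hy => rw [mul_add]; exact Submodule.add_mem _ hx hy
    | smul a x _ hx => rw [mul_smul_comm]; exact Submodule.smul_mem _ _ hx
    | mem x hx =>
      obtain ⟨l', hl', rfl⟩ := hx
      refine Submodule.subset_span ⟨l', fun k hk hkn => ?_, ?_⟩
      · rw [hl' k hk hkn, hm' k hk hkn]
      · funext z
        simp [detGen, D, Finset.prod_apply]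

/-- The representation `τ_λ` of `GL_n(ℂ)` on `V_λ`, `τ_λ(g) f(z) = f(z g)`. -/
def tau (wt : DomWeight n) (g : GL (Fin n) ℂ) : Vrep wt →ₗ[ℂ] Vrep wt :=
  (rightTranslate g).restrict fun _ hf => rightTranslate_mem_Vrep wt g hf


/-! ### Operations on weights -/

/-- `λ^∨ = (-λ_n, …, -λ_1)`. -/
def DomWeight.dual (wt : DomWeight n) : DomWeight n where
  toFun i := -wt (Fin.rev i)
  anti i j h := by
    have := wt.anti (Fin.rev_le_rev.mpr h)
    simpa using this

/-- `λ + l = (λ_1 + l, …, λ_n + l)` for an integer `l`. -/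
def DomWeight.shift (wt : DomWeight n) (l : ℤ) : DomWeight n where
  toFun i := wt i + l
  anti i j h := by simpa using wt.anti h

instance : Add (DomWeight n) where
  add x y := ⟨fun i => x i + y i, fun _ _ h => add_le_add (x.anti h) (y.anti h)⟩

/-- `2ρ_n = (n - 1, n - 3, …, 1 - n)`. -/
def twoRho (n : ℕ) : DomWeight n where
  toFun i := (n : ℤ) - 1 - 2 * (i : ℕ)
  anti i j h := by
    have : (i : ℕ) ≤ j := h
    dsimp only
    omega

theorem DomWeight.add_apply (x y : DomWeight n) (i : Fin n) : (x + y) i = x i + y i := rfl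

/-- If `d = 2λ + 2ρ_n - w` then `d^∨ = 2ρ_n + (2λ^∨ + w)`. -/
theorem dual_weight_eq {lam d : DomWeight n} {w : ℤ}
    (hd : ∀ i, d i = 2 * lam i + twoRho n i - w) :
    d.dual = twoRho n + (lam.dual + lam.dual).shift w := by
  ext i
  have hi := i.isLt
  have h1 : ((Fin.rev i : Fin n) : ℕ) = n - (i + 1) := Fin.val_rev i
  simp only [DomWeight.dual, DomWeight.shift, DomWeight.add_apply, hd, twoRho, h1]
  omega

/-- `2λ^∨ + w = λ^∨ + (λ^∨ + w)`. -/
theorem two_dual_shift (lam : DomWeight n) (w : ℤ) :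
    (lam.dual + lam.dual).shift w = lam.dual + lam.dual.shift w := by
  ext i
  simp only [DomWeight.shift, DomWeight.add_apply]
  ring

/-- `λ - w = (λ^∨ + w)^∨`. -/
theorem shift_neg_eq_dual (lam : DomWeight n) (w : ℤ) :
    lam.shift (-w) = (lam.dual.shift w).dual := by
  ext i
  simp only [DomWeight.shift, DomWeight.dual, Fin.rev_rev]
  ring

/-! ### The `det`-twist -/

theorem DomWeight.entry_of_sub {wt wt' : DomWeight n} {l : ℤ} (h : ∀ i, wt' i = wt i - l)
    {i : ℕ} (h1 : 1 ≤ i) (h2 : i ≤ n) : wt'.entry i = wt.entry i - l := by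
  simp [DomWeight.entry, h1, h2, h]

theorem det_zpow_mul_mem {wt wt' : DomWeight n} {l : ℤ} (h : ∀ i, wt' i = wt i - l)
    {f : GL (Fin n) ℂ → ℂ} (hf : f ∈ Vrep wt) :
    (fun g : GL (Fin n) ℂ => (g : Matrix (Fin n) (Fin n) ℂ).det ^ (-l)) * f ∈ Vrep wt' := by
  induction hf using Submodule.span_induction with
  | zero => simp
  | add x y _ _ hx hy => rw [mul_add]; exact Submodule.add_mem _ hx hy
  | smul a x _ hx => rw [mul_smul_comm]; exact Submodule.smul_mem _ _ hx
  | mem x hx =>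
    obtain ⟨e, he, rfl⟩ := hx
    refine Submodule.subset_span ⟨e, fun k hk hkn => ?_, ?_⟩
    · rw [he k hk hkn, DomWeight.entry_of_sub h hk hkn.le,
        DomWeight.entry_of_sub h (by omega) hkn]
      ring
    · funext g
      have hg : (g : Matrix (Fin n) (Fin n) ℂ).det ≠ 0 := by
        have := (Matrix.isUnit_iff_isUnit_det _).mp g.isUnit
        exact this.ne_zero
      rcases Nat.eq_zero_or_pos n with rfl | hn
      · simp [detGen]
      · simp only [Pi.mul_apply, detGen, DomWeight.entry_of_sub h hn le_rfl]
        rw [← mul_assoc, ← zpow_add₀ hg]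
        congr 2
        ring

/-- `I^det_{λ,l} : V_λ → V_{λ-l}`, `v ↦ (det z)^{-l} v`. The target weight `wt'` is a parameter,
equal to `λ - l` by the hypothesis `h`. -/
def detShift (wt wt' : DomWeight n) (l : ℤ) (h : ∀ i, wt' i = wt i - l) :
    Vrep wt →ₗ[ℂ] Vrep wt' where
  toFun v := ⟨(fun g : GL (Fin n) ℂ => (g : Matrix (Fin n) (Fin n) ℂ).det ^ (-l)) * v.1,
    det_zpow_mul_mem h v.2⟩
  map_add' _ _ := Subtype.ext (mul_add _ _ _)
  map_smul' _ _ := Subtype.ext (mul_smul_comm _ _ _)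

/-! ### Highest weight vectors -/

/-- The exponent `h(λ)`: `λ_k - λ_{k+1}` at `I = {1, …, k}`, and `0` elsewhere. -/
def hwExponent (wt : DomWeight n) (I : Finset (Fin n)) : ℕ :=
  if I = Finset.univ.filter (fun i : Fin n => (i : ℕ) < I.card) then
    (wt.entry I.card - wt.entry (I.card + 1)).toNat else 0

theorem isExponent_hwExponent (wt : DomWeight n) : IsExponent wt (hwExponent wt) := by
  intro k hk hkn
  have hcard : (Finset.univ.filter (fun i : Fin n => (i : ℕ) < k)).card = k := by
    rw [Fin.card_filter_val_lt]; omega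
  rw [Finset.sum_eq_single (Finset.univ.filter (fun i : Fin n => (i : ℕ) < k))]
  · simp only [hwExponent, hcard, if_true]
    apply Int.toNat_of_nonneg
    simp only [DomWeight.entry, hk, hkn.le, dif_pos, Nat.succ_le_of_lt hkn,
      Nat.le_add_left, and_self]
    rw [sub_nonneg]
    exact wt.anti (by simp [Fin.le_def])
  · intro I hI hne
    simp only [Finset.mem_filter, Finset.mem_univ, true_and] at hI
    simp only [hwExponent, hI]
    rw [if_neg hne]
  · intro h
    simp [hcard] at h

/-- The highest weight vector `f_{h(λ)} ∈ V_λ`. -/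
def highestVec (wt : DomWeight n) : Vrep wt :=
  ⟨detGen wt (hwExponent wt), Submodule.subset_span ⟨_, isExponent_hwExponent wt, rfl⟩⟩

/-- The inclusion of the unitary group `U(n)` into `GL_n(ℂ)`. -/
def uGL : Matrix.unitaryGroup (Fin n) ℂ →* GL (Fin n) ℂ := Unitary.toUnits

/-- Definite description: `theUnique P` is the unique `x` with `P x`. (A totalised operator: the
value is `0` if there is no such `x` or more than one.) -/
def theUnique {α : Type*} [Zero α] (P : α → Prop) : α :=
  open Classical in if h : ∃! x, P x then h.choose else 0

/-- `B` is a `U(n)`-invariant hermitian inner product on `V_λ` (linear in the first variable) with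
`B(f_{h(λ)}, f_{h(λ)}) = 1`. -/
structure IsInvariantInner (wt : DomWeight n) (B : Vrep wt →ₗ[ℂ] Vrep wt →ₗ⋆[ℂ] ℂ) : Prop where
  hermitian : ∀ v v', B v' v = (starRingEnd ℂ) (B v v')
  positive : ∀ v, v ≠ 0 → 0 < (B v v).re
  invariant : ∀ (k : Matrix.unitaryGroup (Fin n) ℂ) (v v' : Vrep wt),
    B (tau wt (uGL k) v) (tau wt (uGL k) v') = B v v'
  normalised : B (highestVec wt) (highestVec wt) = 1

/-- The inner product `( , )_λ`: the unique one with the properties above (unique as `V_λ` is an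
irreducible representation of `U(n)`). -/
def invInner (wt : DomWeight n) : Vrep wt →ₗ[ℂ] Vrep wt →ₗ⋆[ℂ] ℂ :=
  theUnique (IsInvariantInner wt)

/-! ### Gel'fand–Tsetlin patterns -/

/-- Integral triangular arrays `M = (m_{i,j})`, indexed from `1`; only the entries with
`1 ≤ i ≤ j ≤ n` matter, and patterns are required to vanish elsewhere. -/
abbrev TriArray : Type := ℕ → ℕ → ℤ

/-- The set `G(λ)` of Gel'fand–Tsetlin patterns of type `λ`: the `n`-th row is `λ` and consecutive
rows interlace, `m_{i,j+1} ≥ m_{i,j} ≥ m_{i+1,j+1}` (which makes all rows dominant). -/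
def gtPatterns (wt : DomWeight n) : Set TriArray :=
  {M | (∀ i j, ¬ (1 ≤ i ∧ i ≤ j ∧ j ≤ n) → M i j = 0) ∧
    (∀ i, 1 ≤ i → i ≤ n → M i n = wt.entry i) ∧
    ∀ i j, 1 ≤ i → i ≤ j → j < n → M i j ≤ M i (j + 1) ∧ M (i + 1) (j + 1) ≤ M i j}

theorem gtPatterns_finite (wt : DomWeight n) : (gtPatterns wt).Finite := by
  obtain ⟨C, hC⟩ : ∃ C : ℤ, ∀ i, |wt.entry i| ≤ C := by
    refine ⟨∑ i ∈ Finset.range (n + 1), |wt.entry i|, fun i => ?_⟩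
    by_cases hi : i ∈ Finset.range (n + 1)
    · exact Finset.single_le_sum (f := fun i => |wt.entry i|) (fun _ _ => abs_nonneg _) hi
    · have : wt.entry i = 0 := by
        simp only [Finset.mem_range] at hi
        simp only [DomWeight.entry]
        rw [dif_neg (by omega)]
      rw [this, abs_zero]
      exact Finset.sum_nonneg fun _ _ => abs_nonneg _
  have hC0 : 0 ≤ C := (abs_nonneg _).trans (hC 0)
  have bound : ∀ M ∈ gtPatterns wt, ∀ i j, |M i j| ≤ C := by
    rintro M ⟨h0, h1, h2⟩ i j
    by_cases hij : 1 ≤ i ∧ i ≤ j ∧ j ≤ n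
    · obtain ⟨hi, hij, hj⟩ := hij
      obtain ⟨t, ht⟩ := Nat.exists_eq_add_of_le hj
      induction t generalizing i j with
      | zero =>
        obtain rfl : n = j := by omega
        rw [h1 i hi hij]; exact hC i
      | succ t ih =>
        have ha := ih i (j + 1) hi (by omega) (by omega) (by omega)
        have hb := ih (i + 1) (j + 1) (by omega) (by omega) (by omega) (by omega)
        obtain ⟨h3, h4⟩ := h2 i j hi hij (by omega)
        rw [abs_le] at ha hb ⊢
        omega
    · rw [h0 i j hij, abs_zero]; exact hC0
  let res : TriArray → (Fin (n + 1) → Fin (n + 1) → ℤ) := fun M i j => M i j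
  refine Set.Finite.of_finite_image (f := res) ?_ ?_
  · refine (Set.finite_Icc (fun _ _ => -C) (fun _ _ => C)).subset ?_
    rintro _ ⟨M, hM, rfl⟩
    exact ⟨fun i j => (abs_le.mp (bound M hM i j)).1, fun i j => (abs_le.mp (bound M hM i j)).2⟩
  · intro M hM M' hM' h
    funext i j
    by_cases hij : 1 ≤ i ∧ i ≤ j ∧ j ≤ n
    · exact congrFun (congrFun h ⟨i, by omega⟩) ⟨j, by omega⟩
    · rw [hM.1 i j hij, hM'.1 i j hij]

/-- The pattern `H(λ)`, with entries `h_{i,j} = λ_i`. -/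
def highestPattern (wt : DomWeight n) : TriArray := fun i j =>
  if 1 ≤ i ∧ i ≤ j ∧ j ≤ n then wt.entry i else 0

/-- The dual array `M^∨`, with entries `m^∨_{i,j} = -m_{j+1-i,j}`. -/
def dualArray (M : TriArray) : TriArray := fun i j => -M (j + 1 - i) j

/-- The array obtained from `M` by adding `c` to the `(i,j)`-th entry. -/
def addAt (M : TriArray) (i j : ℕ) (c : ℤ) : TriArray := fun i' j' =>
  M i' j' + if i' = i ∧ j' = j then c else 0

/-- The `j`-th component `γ^M_j` of the weight of `M`. -/
def patternWeight (M : TriArray) (j : ℕ) : ℤ :=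
  ∑ i ∈ Finset.Icc 1 j, M i j - ∑ i ∈ Finset.Icc 1 (j - 1), M i (j - 1)

/-- `q(M) = ∑_{1 ≤ i ≤ j ≤ n-1} m_{i,j}`. -/
def qInv (n : ℕ) (M : TriArray) : ℤ :=
  ∑ j ∈ Finset.Icc 1 (n - 1), ∑ i ∈ Finset.Icc 1 j, M i j

/-- The factorial of a (non-negative) integer, as a real number. -/
def fac (m : ℤ) : ℝ := (m.toNat.factorial : ℝ)

/-- The constant `r(M)`, a product over `1 ≤ i ≤ j < k ≤ n`. All arguments of the factorials are
non-negative when `M` is a Gel'fand–Tsetlin pattern. -/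
def rConst (n : ℕ) (M : TriArray) : ℝ :=
  ∏ k ∈ Finset.Icc 1 n, ∏ j ∈ Finset.Icc 1 (k - 1), ∏ i ∈ Finset.Icc 1 j,
    (fac (M i k - M j (k - 1) - i + j) * fac (M i (k - 1) - M (j + 1) k - i + j)) /
    (fac (M i (k - 1) - M j (k - 1) - i + j) * fac (M i k - M (j + 1) k - i + j))

/-- The coefficient `a_{i,j}(M)`. -/
def gtCoeff (i j : ℕ) (M : TriArray) : ℝ :=
  Real.sqrt |((∏ h ∈ Finset.Icc 1 (j + 1), ((M h (j + 1) - M i j - h + i : ℤ) : ℝ)) *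
      ∏ h ∈ Finset.Icc 1 (j - 1), ((M h (j - 1) - M i j - h + i - 1 : ℤ) : ℝ)) /
    ∏ h ∈ (Finset.Icc 1 j).erase i,
      (((M h j - M i j - h + i : ℤ) : ℝ) * ((M h j - M i j - h + i - 1 : ℤ) : ℝ))|

/-! ### The Gel'fand–Tsetlin basis -/

/-- The matrix unit `E_{i,j}`, with `i, j` counted from `1`. -/
def matUnit (n i j : ℕ) : Matrix (Fin n) (Fin n) ℂ :=
  Matrix.of fun a b => if (a : ℕ) + 1 = i ∧ (b : ℕ) + 1 = j then 1 else 0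

/-- The matrix exponential, with values in `GL_n(ℂ)`. -/
def expGL (X : Matrix (Fin n) (Fin n) ℂ) : GL (Fin n) ℂ := (Matrix.isUnit_exp X).unit

/-- The infinitesimal right translation `(X f)(z) = d/dt f(z exp(tX))` at `t = 0`. -/
def lieAction (X : Matrix (Fin n) (Fin n) ℂ) (f : GL (Fin n) ℂ → ℂ) : GL (Fin n) ℂ → ℂ :=
  fun z => deriv (fun t : ℝ => f (z * expGL ((t : ℂ) • X))) 0

/-- `ζ` is the Gel'fand–Tsetlin basis of `V_λ`: an orthonormal basis `(ζ_M)_{M ∈ G(λ)}` on which the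
generators of `𝔤𝔩_n` act by the Gel'fand–Tsetlin formulas, and with `ζ_{H(λ)} = f_{h(λ)}`. For
convenience `ζ_M = 0` for arrays `M` outside `G(λ)`, so that the sums in the formulas run over the
`i` with `M + Δ_{i,j} ∈ G(λ)`, respectively `M + Δ^∨_{i,j} ∈ G(λ)`; here `Δ_{i,j}` has its only
nonzero entry `1` at `(i,j)`, and `Δ^∨_{i,j}` has its only nonzero entry `-1` at `(j+1-i,j)`. -/
structure IsGTBasis (wt : DomWeight n) (ζ : TriArray → Vrep wt) : Prop where
  off : ∀ M, M ∉ gtPatterns wt → ζ M = 0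
  orthonormal : ∀ M ∈ gtPatterns wt, ∀ M' ∈ gtPatterns wt,
    invInner wt (ζ M) (ζ M') = open Classical in if M = M' then 1 else 0
  spans : Submodule.span ℂ (ζ '' gtPatterns wt) = ⊤
  highest : ζ (highestPattern wt) = highestVec wt
  weight : ∀ M ∈ gtPatterns wt, ∀ k, 1 ≤ k → k ≤ n →
    lieAction (matUnit n k k) (ζ M : GL (Fin n) ℂ → ℂ)
      = (patternWeight M k : ℂ) • (ζ M : GL (Fin n) ℂ → ℂ)
  raising : ∀ M ∈ gtPatterns wt, ∀ j, 1 ≤ j → j < n →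
    lieAction (matUnit n j (j + 1)) (ζ M : GL (Fin n) ℂ → ℂ)
      = ∑ i ∈ Finset.Icc 1 j,
          (gtCoeff i j M : ℂ) • (ζ (addAt M i j 1) : GL (Fin n) ℂ → ℂ)
  lowering : ∀ M ∈ gtPatterns wt, ∀ j, 1 ≤ j → j < n →
    lieAction (matUnit n (j + 1) j) (ζ M : GL (Fin n) ℂ → ℂ)
      = ∑ i ∈ Finset.Icc 1 j,
          (gtCoeff i j (dualArray M) : ℂ) •
            (ζ (addAt M (j + 1 - i) j (-1)) : GL (Fin n) ℂ → ℂ)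

/-- The Gel'fand–Tsetlin basis `ζ_M`, `M ∈ G(λ)` (it exists by the theorem of Gel'fand and Tsetlin,
and is unique since `V_λ` is irreducible and `ζ_{H(λ)}` is fixed). -/
def gtZeta (wt : DomWeight n) : TriArray → Vrep wt := theUnique (IsGTBasis wt)

/-- The rational Gel'fand–Tsetlin basis `ξ_M = √r(M) ζ_M`. -/
def xi (wt : DomWeight n) (M : TriArray) : Vrep wt :=
  ((Real.sqrt (rConst n M) : ℝ) : ℂ) • gtZeta wt M

/-- The underlying space of the complex conjugate representation `V_λ^conj`, which is `V_λ` with `g`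
acting by `τ_λ(ḡ)`. -/
abbrev Vconj (wt : DomWeight n) : Submodule ℂ (GL (Fin n) ℂ → ℂ) := Vrep wt

/-- `I^conj_λ : V_λ → V_{λ^∨}^conj`: the linear map with `ξ_M ↦ (-1)^{q(M)} ξ_{M^∨}` for `M ∈ G(λ)`. The
target weight `wt'` is a parameter, equal to `λ^∨` by hypothesis. -/
def conjIso (wt wt' : DomWeight n) (_h : wt' = wt.dual) : Vrep wt →ₗ[ℂ] Vconj wt' :=
  theUnique fun T => ∀ M ∈ gtPatterns wt,
    T (xi wt M) = ((-1 : ℂ) ^ qInv n M) • xi wt' (dualArray M)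

/-- `T : V_λ → V_{λ₁} ⊗ V_{λ₂}` is a `GL_n(ℂ)`-equivariant injection with
`f_{h(λ)} ↦ f_{h(λ₁)} ⊗ f_{h(λ₂)}`. -/
structure IsCartanInjection (wt₁ wt₂ wt : DomWeight n)
    (T : Vrep wt →ₗ[ℂ] Vrep wt₁ ⊗[ℂ] Vrep wt₂) : Prop where
  injective : Function.Injective T
  equivariant : ∀ (g : GL (Fin n) ℂ) (v : Vrep wt),
    T (tau wt g v) = TensorProduct.map (tau wt₁ g) (tau wt₂ g) (T v)
  highest : T (highestVec wt) = highestVec wt₁ ⊗ₜ[ℂ] highestVec wt₂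

/-- The injection `I^{λ₁,λ₂}_{λ₁+λ₂} : V_{λ₁+λ₂} → V_{λ₁} ⊗ V_{λ₂}` of the Cartan component: the unique
one with the properties above. The weight `wt` is a parameter, equal to `λ₁ + λ₂` by hypothesis. -/
def cartanInj (wt₁ wt₂ wt : DomWeight n) (_h : wt = wt₁ + wt₂) :
    Vrep wt →ₗ[ℂ] Vrep wt₁ ⊗[ℂ] Vrep wt₂ :=
  theUnique (IsCartanInjection wt₁ wt₂ wt)

/-- The `U(n)`-invariant element `[id_{V_d}] = ∑_{M ∈ G(d)} (-1)^{q(M)} r(M)⁻¹ ξ_M ⊗ ξ_{M^∨}` of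
`V_d ⊗ V_{d^∨}`. -/
def idElement (d : DomWeight n) : Vrep d ⊗[ℂ] Vrep d.dual :=
  ∑ M ∈ (gtPatterns_finite d).toFinset,
    ((-1 : ℂ) ^ qInv n M / (rConst n M : ℂ)) • (xi d M ⊗ₜ[ℂ] xi d.dual (dualArray M))

/-! ### Lie algebra -/

/-- `b_n = n(n-1)/2`. -/
def bDeg (n : ℕ) : ℕ := n * (n - 1) / 2

/-- `𝔭⁰_n`: the real space of hermitian `n × n` matrices of trace zero. -/
def pZero (n : ℕ) : Submodule ℝ (Matrix (Fin n) (Fin n) ℂ) where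
  carrier := {X | X.IsHermitian ∧ X.trace = 0}
  add_mem' := fun ha hb => ⟨ha.1.add hb.1, by rw [Matrix.trace_add, ha.2, hb.2, add_zero]⟩
  zero_mem' := ⟨Matrix.isHermitian_zero, Matrix.trace_zero _ _⟩
  smul_mem' := fun c X hX => ⟨by
    have h : Xᴴ = X := hX.1
    change (c • X)ᴴ = c • X
    rw [Matrix.conjTranspose_smul, h, star_trivial], by
    rw [Matrix.trace_smul, hX.2, smul_zero]⟩

/-- The complexification `𝔭⁰_{nℂ}`. -/
abbrev pZeroC (n : ℕ) : Type := ℂ ⊗[ℝ] pZero n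

/-- The adjoint action of `k ∈ U(n)` on `𝔭⁰_n`, `X ↦ k X k⁻¹`. -/
def adj (k : Matrix.unitaryGroup (Fin n) ℂ) : pZero n →ₗ[ℝ] pZero n where
  toFun X := ⟨(k : Matrix (Fin n) (Fin n) ℂ) * X.1 * star (k : Matrix (Fin n) (Fin n) ℂ), by
    refine ⟨?_, ?_⟩
    · rw [Matrix.star_eq_conjTranspose]
      exact Matrix.isHermitian_mul_mul_conjTranspose _ X.2.1
    · rw [Matrix.trace_mul_comm, ← mul_assoc, Matrix.UnitaryGroup.star_mul_self, one_mul, X.2.2]⟩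
  map_add' X Y := Subtype.ext (by simp [mul_add, add_mul])
  map_smul' c X := Subtype.ext (by simp)

/-- The contragredient `Ad^∨` of the adjoint action, on the dual `𝔭^{0∨}_{nℂ}`. -/
def adjDual (k : Matrix.unitaryGroup (Fin n) ℂ) :
    Module.Dual ℂ (pZeroC n) →ₗ[ℂ] Module.Dual ℂ (pZeroC n) :=
  ((adj k⁻¹).baseChange ℂ).dualMap

/-- The action of `U(n)` on `⋀^{b_n} 𝔭^{0∨}_{nℂ}` induced by `Ad^∨`. -/
def extAdjDual (k : Matrix.unitaryGroup (Fin n) ℂ) :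
    (⋀[ℂ]^(bDeg n) (Module.Dual ℂ (pZeroC n))) →ₗ[ℂ] ⋀[ℂ]^(bDeg n) (Module.Dual ℂ (pZeroC n)) :=
  exteriorPower.map (bDeg n) (adjDual k)

/-- The restriction to `𝔭⁰_{nℂ}` of the functional `E^{𝔭_n∨}_{i,j}` on `𝔭_{nℂ}`, namely
`c ⊗ X ↦ c X_{i,j}`. Indeed, under the isomorphism `𝔭_{nℂ} ≅ M_n(ℂ)`, `c ⊗ X ↦ c X`, the vector
`E^{𝔭_n}_{i,j} = ½(1 ⊗ (E_{i,j} + E_{j,i}) - √-1 ⊗ √-1 (E_{i,j} - E_{j,i}))` corresponds to `E_{i,j}`, so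
these functionals form the basis dual to the `E^{𝔭_n}_{i,j}`. (For `i ≠ j` the functional vanishes on
the centre, so nothing is lost by restricting it.) -/
def Epdual (i j : Fin n) : Module.Dual ℂ (pZeroC n) :=
  LinearMap.liftBaseChange ℂ
    ({ toFun := fun X => X.1 i j
       map_add' := fun _ _ => rfl
       map_smul' := fun _ _ => rfl } : pZero n →ₗ[ℝ] ℂ)

/-- The pairs `(i,j)` with `i > j`; the order on them is lexicographic:
`(2,1), (3,1), (3,2), (4,1), …`. -/
def lowerPairs (n : ℕ) : Finset (Fin n ×ₗ Fin n) :=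
  Finset.univ.filter fun p => (ofLex p).2 < (ofLex p).1

theorem card_lowerPairs (n : ℕ) : (lowerPairs n).card = bDeg n := by
  have h1 : (lowerPairs n).card
      = ((Finset.univ : Finset (Fin n × Fin n)).filter fun p => p.2 < p.1).card := rfl
  rw [h1, Finset.card_filter, Fintype.sum_prod_type]
  simp_rw [← Finset.card_filter]
  have h2 : ∀ i : Fin n, (Finset.univ.filter fun j : Fin n => j < i).card = (i : ℕ) := by
    intro i
    have : (Finset.univ.filter fun j : Fin n => j < i) = Finset.Iio i := by ext; simp
    rw [this, Fin.card_Iio]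
  simp_rw [h2]
  rw [Fin.sum_univ_eq_sum_range (fun i => i) n, Finset.sum_range_id, bDeg]

/-- The wedge `E^∨_{2,1} ∧ E^∨_{3,1} ∧ E^∨_{3,2} ∧ ⋯ ∧ E^∨_{n,n-1}` of the `E^{𝔭_n∨}_{i,j}` with `i > j`. -/
def lowerWedge (n : ℕ) : ⋀[ℂ]^(bDeg n) (Module.Dual ℂ (pZeroC n)) :=
  exteriorPower.ιMulti ℂ (bDeg n) fun m =>
    let p := ofLex ((lowerPairs n).orderEmbOfFin (card_lowerPairs n) m)
    Epdual p.1 p.2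

/-- `I^{𝔭_n}_{2ρ_n} : V_{2ρ_n} → ⋀^{b_n} 𝔭^{0∨}_{nℂ}`: the unique `U(n)`-equivariant linear map sending the
highest weight vector `ξ_{H(2ρ_n)} = f_{h(2ρ_n)}` to the wedge above, which is a highest weight vector
of weight `2ρ_n`. -/
def wedgeHom (n : ℕ) :
    Vrep (twoRho n) →ₗ[ℂ] ⋀[ℂ]^(bDeg n) (Module.Dual ℂ (pZeroC n)) :=
  theUnique fun T =>
    (∀ (k : Matrix.unitaryGroup (Fin n) ℂ) (v : Vrep (twoRho n)),
      T (tau (twoRho n) (uGL k) v) = extAdjDual k (T v)) ∧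
    T (highestVec (twoRho n)) = lowerWedge n

/-! ### Principal series -/

/-- The extension by zero of a function on `GL_n(ℂ)` to the space of all matrices. -/
def zeroExt (f : GL (Fin n) ℂ → ℂ) (A : Fin n → Fin n → ℂ) : ℂ :=
  open Classical in
  if h : (Matrix.of A).det ≠ 0 then f (Matrix.GeneralLinearGroup.mkOfDetNeZero (Matrix.of A) h)
  else 0

/-- `f ∈ C^∞(GL_n(ℂ))`, where `GL_n(ℂ)` is an open subset of the real vector space of matrices. -/
def IsSmoothGL (f : GL (Fin n) ℂ → ℂ) : Prop :=
  ContDiffOn ℝ ((⊤ : ℕ∞) : WithTop ℕ∞) (zeroExt f) {A | (Matrix.of A).det ≠ 0}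

/-- The index set of the coordinates `x_{i,j}`, `i < j`, of the group `N_n(ℂ)`. -/
abbrev StrictUpper (n : ℕ) : Type := {p : Fin n × Fin n // p.1 < p.2}

/-- The upper triangular matrix with diagonal entries `1` and entries `x_{i,j}` above the diagonal. -/
def unipMatrix (x : StrictUpper n → ℂ) : Matrix (Fin n) (Fin n) ℂ :=
  Matrix.of fun i j => if h : i < j then x ⟨(i, j), h⟩ else if i = j then 1 else 0

theorem det_unipMatrix (x : StrictUpper n → ℂ) : (unipMatrix x).det = 1 := by
  rw [Matrix.det_of_isUpperTriangular]
  · simp [unipMatrix]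
  · intro i j hij
    have : ¬ i < j := not_lt.mpr (le_of_lt hij)
    have h2 : i ≠ j := ne_of_gt hij
    simp [unipMatrix, this, h2]

/-- The element of `N_n(ℂ)` with coordinates `x`. -/
def unip (x : StrictUpper n → ℂ) : GL (Fin n) ℂ :=
  Matrix.GeneralLinearGroup.mkOfDetNeZero (unipMatrix x) (by rw [det_unipMatrix]; exact one_ne_zero)

/-- The element `diag(a_1, …, a_n)` of `T_n(ℂ)`. -/
def torus (a : Fin n → ℂˣ) : GL (Fin n) ℂ :=
  ⟨Matrix.diagonal fun i => (a i : ℂ), Matrix.diagonal fun i => ((a i)⁻¹ : ℂˣ),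
    by simp, by simp⟩

theorem antidiag_sq (n : ℕ) :
    (Matrix.of fun i j : Fin n => if j = Fin.rev i then (1 : ℂ) else 0) *
      (Matrix.of fun i j : Fin n => if j = Fin.rev i then (1 : ℂ) else 0) = 1 := by
  ext i j
  rw [Matrix.mul_apply, Finset.sum_eq_single (Fin.rev i)]
  · simp [Matrix.one_apply, eq_comm]
  · intro b _ hb; simp [hb]
  · intro h; exact absurd (Finset.mem_univ _) h

/-- The antidiagonal matrix `w_n`. -/
def antidiag (n : ℕ) : GL (Fin n) ℂ :=
  ⟨Matrix.of fun i j => if j = Fin.rev i then 1 else 0,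
   Matrix.of fun i j => if j = Fin.rev i then 1 else 0,
   antidiag_sq n, antidiag_sq n⟩

/-- The character `χ_{d,ν}(a) = ∏_i (a_i/|a_i|)^{d_i} |a_i|^{2ν_i}` of `T_n(ℂ)`. -/
def torusChar (d : Fin n → ℤ) (ν : Fin n → ℂ) (a : Fin n → ℂˣ) : ℂ :=
  ∏ i, ((a i : ℂ) / (‖(a i : ℂ)‖ : ℂ)) ^ d i * ((‖(a i : ℂ)‖ : ℂ)) ^ (2 * ν i)

/-- `ρ_{n,i} = (n+1)/2 - i`, with `i` counted from `1`. -/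
def rho (n : ℕ) (i : Fin n) : ℂ := ((n : ℂ) + 1) / 2 - ((i : ℕ) + 1)

theorem zeroExt_add (f f' : GL (Fin n) ℂ → ℂ) : zeroExt (f + f') = zeroExt f + zeroExt f' := by
  funext A
  by_cases h : (Matrix.of A).det = 0 <;> simp [zeroExt, h]

theorem zeroExt_smul (c : ℂ) (f : GL (Fin n) ℂ → ℂ) : zeroExt (c • f) = c • zeroExt f := by
  funext A
  by_cases h : (Matrix.of A).det = 0 <;> simp [zeroExt, h]

theorem IsSmoothGL.rightTranslate {f : GL (Fin n) ℂ → ℂ} (hf : IsSmoothGL f)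
    (g : GL (Fin n) ℂ) : IsSmoothGL (rightTranslate g f) := by
  have hgdet : (g : Matrix (Fin n) (Fin n) ℂ).det ≠ 0 :=
    ((Matrix.isUnit_iff_isUnit_det _).mp g.isUnit).ne_zero
  let L : (Fin n → Fin n → ℂ) → (Fin n → Fin n → ℂ) := fun A i j =>
    ∑ m, A i m * (g : Matrix (Fin n) (Fin n) ℂ) m j
  have hLdef : ∀ A, Matrix.of (L A) = Matrix.of A * (g : Matrix (Fin n) (Fin n) ℂ) := by
    intro A; ext i j; simp [L, Matrix.mul_apply]
  have hL : ContDiff ℝ ((⊤ : ℕ∞) : WithTop ℕ∞) L := by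
    refine contDiff_pi.mpr fun i => contDiff_pi.mpr fun j => ?_
    refine ContDiff.sum fun m _ => ?_
    refine ContDiff.mul ?_ contDiff_const
    exact (contDiff_apply_apply ℝ ℂ i m)
  have hmaps : Set.MapsTo L {A | (Matrix.of A).det ≠ 0} {A | (Matrix.of A).det ≠ 0} := by
    intro A hA
    change (Matrix.of (L A)).det ≠ 0
    rw [hLdef, Matrix.det_mul]
    exact mul_ne_zero hA hgdet
  refine (ContDiffOn.comp hf hL.contDiffOn hmaps).congr fun A hA => ?_
  have hA' : (Matrix.of A).det ≠ 0 := hA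
  have hLA : (Matrix.of (L A)).det ≠ 0 := hmaps hA
  simp only [zeroExt, Function.comp, dif_pos hA', dif_pos hLA, CohGen.rightTranslate_apply]
  congr 1
  ext i j
  have := congrFun (congrFun (hLdef A) i) j
  exact this.symm

/-- The space `I^∞_{B_n}(d,ν)` of the smooth principal series representation `π_{B_n,d,ν}`. -/
def principalSeries (d : Fin n → ℤ) (ν : Fin n → ℂ) : Submodule ℂ (GL (Fin n) ℂ → ℂ) where
  carrier := {f | IsSmoothGL f ∧
    ∀ (x : StrictUpper n → ℂ) (a : Fin n → ℂˣ) (g : GL (Fin n) ℂ),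
      f (unip x * torus a * g) = torusChar d (ν + rho n) a * f g}
  add_mem' := fun {f f'} hf hf' => ⟨by
    change ContDiffOn _ _ _ _
    rw [zeroExt_add]; exact ContDiffOn.add hf.1 hf'.1, fun x a g => by
    simp only [Pi.add_apply, hf.2, hf'.2]; ring⟩
  zero_mem' := ⟨by
    have h : zeroExt (0 : GL (Fin n) ℂ → ℂ) = fun _ => 0 := by
      funext A; simp [zeroExt]
    change ContDiffOn _ _ _ _
    rw [h]; exact contDiffOn_const, fun x a g => by simp⟩
  smul_mem' := fun c f hf => ⟨by
    change ContDiffOn _ _ _ _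
    rw [zeroExt_smul]; exact ContDiffOn.const_smul c hf.1, fun x a g => by
    simp only [Pi.smul_apply, smul_eq_mul, hf.2]; ring⟩

/-- The action of `GL_n(ℂ)` on `I^∞_{B_n}(d,ν)`, `(π_{B_n,d,ν}(g) f)(h) = f(h g)`. -/
def psAction (d : Fin n → ℤ) (ν : Fin n → ℂ) (g : GL (Fin n) ℂ) :
    principalSeries d ν →ₗ[ℂ] principalSeries d ν :=
  (rightTranslate g).restrict fun f hf => ⟨hf.1.rightTranslate g, fun x a h => by
    simp only [rightTranslate_apply, mul_assoc]
    rw [← hf.2 x a (h * g)]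
    simp only [mul_assoc]⟩

/-- The additive character `ψ_ε(z) = exp(ε 2π √-1 (z + z̄))` of `ℂ`. -/
def psi (ε : ℤˣ) (z : ℂ) : ℂ :=
  Complex.exp (((ε : ℤ) : ℂ) * (2 * (Real.pi : ℂ) * Complex.I * (z + (starRingEnd ℂ) z)))

/-- The character `ψ_{ε,N_n}(x) = ψ_ε(x_{1,2} + x_{2,3} + ⋯ + x_{n-1,n})` of `N_n(ℂ)`. -/
def psiN (ε : ℤˣ) (x : StrictUpper n → ℂ) : ℂ :=
  psi ε (∑ p : StrictUpper n, if (p.1.1 : ℕ) + 1 = p.1.2 then x p else 0)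

/-- The Jacquet integral `∫_{N_n(ℂ)} f(w_n x) ψ_{-ε,N_n}(x) dx`. Each coordinate carries twice the Lebesgue
measure of `ℂ`, whence the factor `2^{b_n}`. -/
def jacquetIntegral (ε : ℤˣ) (f : GL (Fin n) ℂ → ℂ) : ℂ :=
  (2 : ℂ) ^ bDeg n * ∫ x : StrictUpper n → ℂ, f (antidiag n * unip x) * psiN (-ε) x

/-- A standard section: a family `F_ν ∈ I^∞_{B_n}(d,ν)`, `ν ∈ ℂⁿ`, with the restriction of `F_ν` to `U(n)`
independent of `ν`. -/
def IsStandardSection (d : Fin n → ℤ) (F : ∀ ν : Fin n → ℂ, principalSeries d ν) : Prop :=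
  ∀ (ν ν' : Fin n → ℂ) (k : Matrix.unitaryGroup (Fin n) ℂ),
    (F ν : GL (Fin n) ℂ → ℂ) (uGL k) = (F ν' : GL (Fin n) ℂ → ℂ) (uGL k)

/-- `J_ν`, `ν ∈ ℂⁿ`, is the holomorphic continuation of the Jacquet integral: a family of linear forms on
the `I^∞_{B_n}(d,ν)` which is given by the Jacquet integral where `Re ν_1 > ⋯ > Re ν_n` and is
holomorphic in `ν ∈ ℂⁿ` along each standard section. -/
structure IsJacquetContinuation (ε : ℤˣ) (d : Fin n → ℤ)
    (J : ∀ ν : Fin n → ℂ, principalSeries d ν →ₗ[ℂ] ℂ) : Prop where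
  eq_integral : ∀ ν : Fin n → ℂ, (∀ i j, i < j → (ν j).re < (ν i).re) →
    ∀ f : principalSeries d ν, J ν f = jacquetIntegral ε (f : GL (Fin n) ℂ → ℂ)
  holomorphic : ∀ F, IsStandardSection d F → Differentiable ℂ fun ν : Fin n → ℂ => J ν (F ν)

/-- The Jacquet integral `𝓙_ε` on `I^∞_{B_n}(d,ν)`, for all `ν ∈ ℂⁿ`, defined by holomorphic continuation
along standard sections. (The continuation is known to exist; it is unique by the identity theorem.) -/
def jacquet (ε : ℤˣ) (d : Fin n → ℤ) : ∀ ν : Fin n → ℂ, principalSeries d ν →ₗ[ℂ] ℂ :=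
  theUnique (IsJacquetContinuation ε d)

/-- `W_ε(f)(g) = 𝓙_ε(π_{B_n,d,ν}(g) f)`. -/
def whittaker (ε : ℤˣ) (d : Fin n → ℤ) (ν : Fin n → ℂ) :
    principalSeries d ν →ₗ[ℂ] (GL (Fin n) ℂ → ℂ) :=
  LinearMap.pi fun g => jacquet ε d ν ∘ₗ psAction d ν g

/-- The space `𝓦(π_{B_n,d,ν}, ψ_ε) = {W_ε(f) | f ∈ I^∞_{B_n}(d,ν)}`. -/
def WhittakerModel (ε : ℤˣ) (d : Fin n → ℤ) (ν : Fin n → ℂ) :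
    Submodule ℂ (GL (Fin n) ℂ → ℂ) :=
  LinearMap.range (whittaker ε d ν)

/-- For dominant `d`, the `U(n)`-embedding `f_{B_n,d,ν} : V_d → I^∞_{B_n}(d,ν)` of the minimal `U(n)`-type,
normalised by `f_{B_n,d,ν}(ξ_{H(d)})(1_n) = 1`, where `ξ_{H(d)} = f_{h(d)}`. -/
def minKType (d : DomWeight n) (ν : Fin n → ℂ) : Vrep d →ₗ[ℂ] principalSeries d ν :=
  theUnique fun T => Function.Injective T ∧
    (∀ (k : Matrix.unitaryGroup (Fin n) ℂ) (v : Vrep d),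
      T (tau d (uGL k) v) = psAction d ν (uGL k) (T v)) ∧
    (T (highestVec d) : GL (Fin n) ℂ → ℂ) 1 = 1

/-- `Γ_n(ν;d) = ∏_{i<j} Γ(ν_i - ν_j + 1 + |d_i - d_j|/2)`. -/
def gammaFactor (d : Fin n → ℤ) (ν : Fin n → ℂ) : ℂ :=
  ∏ p : StrictUpper n,
    Complex.Gamma (ν p.1.1 - ν p.1.2 + 1 + ((|d p.1.1 - d p.1.2| : ℤ) : ℂ) / 2)

/-- The normalised Whittaker map `𝐖^{(ε)}_{d,ν} : V_d → 𝓦(π_{B_n,d,ν}, ψ_ε)` for dominant `d`,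
`v ↦ (-1)^{∑ (i-1) d_i} (ε√-1)^{∑ (i-1) d_i} Γ_n(ν;d) W_ε(f_{B_n,d,ν}(v))`. -/
def normWhittaker (ε : ℤˣ) (d : DomWeight n) (ν : Fin n → ℂ) :
    Vrep d →ₗ[ℂ] WhittakerModel ε d ν :=
  (((-1 : ℂ) ^ (∑ i : Fin n, ((i : ℕ) : ℤ) * d i)
      * (((ε : ℤ) : ℂ) * Complex.I) ^ (∑ i : Fin n, ((i : ℕ) : ℤ) * d i)
      * gammaFactor d ν)) •
    ((whittaker ε d ν).rangeRestrict ∘ₗ minKType d ν)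

/-- The space `𝓦(π_{B_n,d,w/2}, ψ_ε) ⊗ ⋀^{b_n} 𝔭^{0∨}_{nℂ} ⊗ V_{λ^∨} ⊗ V^conj_{λ-w}`. -/
abbrev GenSpace (ε : ℤˣ) (d : DomWeight n) (lam : DomWeight n) (w : ℤ) : Type :=
  WhittakerModel ε d (fun _ => (w : ℂ) / 2) ⊗[ℂ]
    ((⋀[ℂ]^(bDeg n) (Module.Dual ℂ (pZeroC n))) ⊗[ℂ]
      (Vrep lam.dual ⊗[ℂ] Vconj (lam.shift (-w))))

/-- The composite map
`V_d ⊗ V_{d^∨} → V_d ⊗ V_{2ρ_n} ⊗ V_{2λ^∨+w} → V_d ⊗ V_{2ρ_n} ⊗ V_{λ^∨} ⊗ V_{λ^∨+w}`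
`→ 𝓦(π_{B_n,d,w/2}, ψ_ε) ⊗ ⋀^{b_n} 𝔭^{0∨}_{nℂ} ⊗ V_{λ^∨} ⊗ V^conj_{λ-w}`
formed from the Cartan injections, `𝐖^{(ε)}_{d,w/2}`, `I^{𝔭_n}_{2ρ_n}` and `I^conj_{λ^∨+w}`. -/
def genMap (ε : ℤˣ) (lam : DomWeight n) (w : ℤ) (d : DomWeight n)
    (hd : ∀ i, d i = 2 * lam i + twoRho n i - w) :
    Vrep d ⊗[ℂ] Vrep d.dual →ₗ[ℂ] GenSpace ε d lam w :=
  TensorProduct.map (normWhittaker ε d fun _ => (w : ℂ) / 2)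
      (TensorProduct.map (wedgeHom n)
        (TensorProduct.map LinearMap.id
          (conjIso (lam.dual.shift w) (lam.shift (-w)) (shift_neg_eq_dual lam w)))) ∘ₗ
    TensorProduct.map LinearMap.id
      (TensorProduct.map LinearMap.id
        (cartanInj lam.dual (lam.dual.shift w) ((lam.dual + lam.dual).shift w)
          (two_dual_shift lam w))) ∘ₗ
    TensorProduct.map LinearMap.id
      (cartanInj (twoRho n) ((lam.dual + lam.dual).shift w) d.dual (dual_weight_eq hd))

/-- The generator `[π_{B_n,d,w/2}]_ε`, where `d = 2λ + 2ρ_n - w`: the image of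
`(ε√-1)^{b_n w} [id_{V_d}]` under the map above. -/
def cohGenerator (ε : ℤˣ) (lam : DomWeight n) (w : ℤ) (d : DomWeight n)
    (hd : ∀ i, d i = 2 * lam i + twoRho n i - w) : GenSpace ε d lam w :=
  genMap ε lam w d hd
    ((((ε : ℤ) : ℂ) * Complex.I) ^ ((bDeg n : ℤ) * w) • idElement d)

/-- The algebraic character `κ_{a,b}(z) = z^a z̄^b` of `ℂ^×`. -/
def kappa (a b : ℤ) (z : ℂ) : ℂ := z ^ a * ((starRingEnd ℂ) z) ^ b

theorem twisted_weight {lam d : DomWeight n} {w : ℤ}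
    (hd : ∀ i, d i = 2 * lam i + twoRho n i - w) (a b : ℤ) (i : Fin n) :
    d.shift (a - b) i = 2 * lam.shift a i + twoRho n i - (w + a + b) := by
  simp only [DomWeight.shift, hd]; ring

theorem dual_shift_apply (lam : DomWeight n) (a : ℤ) (i : Fin n) :
    (lam.shift a).dual i = lam.dual i - a := by
  simp only [DomWeight.shift, DomWeight.dual]; ring

theorem shift_shift_apply (lam : DomWeight n) (w a b : ℤ) (i : Fin n) :
    (lam.shift a).shift (-(w + a + b)) i = lam.shift (-w) i - b := by
  simp only [DomWeight.shift]; ring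


end

end CohGen

open CohGen

namespace CohGen

noncomputable section

variable {n : ℕ}

/-! ### Transport of definite descriptions -/

/-! Multiplication by a power of `det` identifies `V_λ` with `V_{λ-l}`, and multiplication by
`κ_{a,b}(det)` identifies `I^∞(d,ν)` with `I^∞(d+a-b, ν+(a+b)/2)`. Every ingredient of the generator
is natural under these twists up to an explicit sign or power of `ε√-1`, so the theorem reduces to
multiplying these scalars.

The ingredients are given by definite descriptions. `theUnique_transport` shows that a bijection
matching two defining properties and fixing `0` matches the described objects, whether or not they
exist: if one description fails, so does the other, and both values are `0`. Hence neither the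
Gel'fand–Tsetlin theorem nor the continuation of Jacquet integrals nor irreducibility is needed; it
suffices to twist each defining property, as the `twist` lemmas do.

The scalars arise as follows, with `B = b_n`. Adding `l` to all entries of a pattern leaves `r(M)`
unchanged and adds `B l` to `q(M)`. This gives `(-1)^{B(b-a)}` for the invariant element
(`idElement_twist`) and `(-1)^{B b}` for the conjugation map (`conjIso_twist`). The Cartan
injections (`cartanInj_twist`) and the Gamma factor contribute nothing, and `2ρ_n` is not twisted.
The Whittaker map (`normWhittaker_twist`) contributes the inverse of `κ_{a,b}(det w_n) =
(-1)^{B(a+b)}`, because the Jacquet integral evaluates `f` on `w_n N_n`, and the change of its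
normalising power, because `∑(i-1)d_i` grows by `B(a-b)`. `sign_identity` shows that together they
turn `(ε√-1)^{B w}` into `(ε√-1)^{B(w+a+b)}`. -/

theorem theUnique_transport {α β : Type*} [Zero α] [Zero β] {P : α → Prop} {Q : β → Prop}
    (f : α → β) (g : β → α) (hgf : ∀ x, g (f x) = x) (hfg : ∀ y, f (g y) = y) (h0 : f 0 = 0)
    (hP : ∀ x, P x → Q (f x)) (hQ : ∀ y, Q y → P (g y)) :
    theUnique Q = f (theUnique P) := by
  by_cases h : ∃! x, P x
  · have h' : ∃! y, Q y := by
      obtain ⟨x, hx, hu⟩ := h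
      exact ⟨f x, hP x hx, fun y hy => by rw [← hfg y, hu _ (hQ y hy)]⟩
    have e1 : theUnique P = h.choose := dif_pos h
    have e2 : theUnique Q = h'.choose := dif_pos h'
    rw [e1, e2]
    exact h'.unique h'.choose_spec.1 (hP _ h.choose_spec.1)
  -- If one side has no unique solution, neither has the other; both values are then the default
  -- `0`, which `h0` matches.
  · have h' : ¬ ∃! y, Q y := by
      rintro ⟨y, hy, hu⟩
      exact h ⟨g y, hQ y hy, fun x hx => by rw [← hgf x, hu _ (hP x hx)]⟩
    have e1 : theUnique P = 0 := dif_neg h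
    have e2 : theUnique Q = 0 := dif_neg h'
    rw [e1, e2, h0]

/-! ### The determinant twist as an equivalence -/

theorem det_ne_zero (g : GL (Fin n) ℂ) : (g : Matrix (Fin n) (Fin n) ℂ).det ≠ 0 :=
  ((Matrix.isUnit_iff_isUnit_det _).mp g.isUnit).ne_zero

theorem detShift_apply {wt wt' : DomWeight n} {l : ℤ} (h : ∀ i, wt' i = wt i - l)
    (v : Vrep wt) (g : GL (Fin n) ℂ) :
    (detShift wt wt' l h v : GL (Fin n) ℂ → ℂ) g
      = (g : Matrix (Fin n) (Fin n) ℂ).det ^ (-l) * (v : GL (Fin n) ℂ → ℂ) g := rfl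

/-- Lets each twist lemma be reused with the two weights exchanged, which supplies the backward
direction required by `theUnique_transport`. -/
theorem eq_sub_neg {wt wt' : DomWeight n} {l : ℤ} (h : ∀ i, wt' i = wt i - l) (i : Fin n) :
    wt i = wt' i - -l := by rw [h]; ring

theorem detShift_detShift {wt wt' : DomWeight n} {l : ℤ} (h : ∀ i, wt' i = wt i - l)
    (h' : ∀ i, wt i = wt' i - -l) (v : Vrep wt) :
    detShift wt' wt (-l) h' (detShift wt wt' l h v) = v := by
  refine Subtype.ext (funext fun g => ?_)
  rw [detShift_apply, detShift_apply, ← mul_assoc, ← zpow_add₀ (det_ne_zero g)]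
  simp

/-- Multiplication by `(det z)^{-l}` as an equivalence `V_λ ≃ V_{λ-l}`. -/
def detEquiv (wt wt' : DomWeight n) (l : ℤ) (h : ∀ i, wt' i = wt i - l) :
    Vrep wt ≃ₗ[ℂ] Vrep wt' :=
  { detShift wt wt' l h with
    invFun := detShift wt' wt (-l) (eq_sub_neg h)
    left_inv := detShift_detShift h _
    right_inv := fun v => by
      refine Subtype.ext (funext fun g => ?_)
      change (detShift wt wt' l h (detShift wt' wt (-l) (eq_sub_neg h) v) : GL (Fin n) ℂ → ℂ) g = _
      rw [detShift_apply, detShift_apply, ← mul_assoc, ← zpow_add₀ (det_ne_zero g)]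
      simp }

theorem detEquiv_apply {wt wt' : DomWeight n} {l : ℤ} (h : ∀ i, wt' i = wt i - l)
    (v : Vrep wt) (g : GL (Fin n) ℂ) :
    (detEquiv wt wt' l h v : GL (Fin n) ℂ → ℂ) g
      = (g : Matrix (Fin n) (Fin n) ℂ).det ^ (-l) * (v : GL (Fin n) ℂ → ℂ) g := rfl

theorem detEquiv_symm {wt wt' : DomWeight n} {l : ℤ} (h : ∀ i, wt' i = wt i - l) :
    (detEquiv wt wt' l h).symm = detEquiv wt' wt (-l) (eq_sub_neg h) :=
  LinearEquiv.ext fun _ => rfl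

theorem detEquiv_neg_symm {wt wt' : DomWeight n} {l : ℤ} (h : ∀ i, wt' i = wt i - l) :
    (detEquiv wt' wt (-l) (eq_sub_neg h)).symm = detEquiv wt wt' l h := by
  rw [← detEquiv_symm, LinearEquiv.symm_symm]

theorem tau_apply (wt : DomWeight n) (g z : GL (Fin n) ℂ) (v : Vrep wt) :
    (tau wt g v : GL (Fin n) ℂ → ℂ) z = (v : GL (Fin n) ℂ → ℂ) (z * g) := rfl

/-- The twist is equivariant only up to the character `det^{-l}`, by multiplicativity of `det`. Each
equivariance or invariance condition below survives because these characters cancel. -/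
theorem tau_detEquiv {wt wt' : DomWeight n} {l : ℤ} (h : ∀ i, wt' i = wt i - l)
    (g : GL (Fin n) ℂ) (v : Vrep wt) :
    tau wt' g (detEquiv wt wt' l h v)
      = ((g : Matrix (Fin n) (Fin n) ℂ).det ^ (-l)) • detEquiv wt wt' l h (tau wt g v) := by
  refine Subtype.ext (funext fun z => ?_)
  change (detEquiv wt wt' l h v : GL (Fin n) ℂ → ℂ) (z * g)
    = _ * (detEquiv wt wt' l h (tau wt g v) : GL (Fin n) ℂ → ℂ) z
  rw [detEquiv_apply, detEquiv_apply, tau_apply, Units.val_mul, Matrix.det_mul, mul_zpow]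
  ring

/-- Only differences of consecutive entries occur. The restriction to nonempty proper subsets
matters: outside `1 ≤ i ≤ n` the entry is `0` by convention and does not shift. -/
theorem hwExponent_eq {wt wt' : DomWeight n} {l : ℤ} (h : ∀ i, wt' i = wt i - l)
    {I : Finset (Fin n)} (hI : I ∈ properSubsets n) : hwExponent wt' I = hwExponent wt I := by
  simp only [properSubsets, Finset.mem_filter, Finset.mem_univ, true_and] at hI
  simp only [hwExponent, DomWeight.entry_of_sub h (i := I.card) hI.1 hI.2.le,
    DomWeight.entry_of_sub h (i := I.card + 1) (by omega) hI.2]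
  congr 2
  ring

theorem detEquiv_highestVec {wt wt' : DomWeight n} {l : ℤ} (h : ∀ i, wt' i = wt i - l) :
    detEquiv wt wt' l h (highestVec wt) = highestVec wt' := by
  refine Subtype.ext (funext fun g => ?_)
  rw [detEquiv_apply]
  change _ * detGen wt (hwExponent wt) g = detGen wt' (hwExponent wt') g
  simp only [detGen]
  rw [Finset.prod_congr rfl fun I hI =>
    show minor I g ^ hwExponent wt' I = minor I g ^ hwExponent wt I by rw [hwExponent_eq h hI]]
  -- For `n = 0` the entry at `n` is the default `0` and does not shift, but then `det = 1`.
  rcases Nat.eq_zero_or_pos n with h0 | hn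
  · subst h0; simp
  · rw [DomWeight.entry_of_sub h hn le_rfl, ← mul_assoc, ← zpow_add₀ (det_ne_zero g)]
    congr 2
    ring

/-! ### The invariant inner product -/

theorem norm_det_uGL (k : Matrix.unitaryGroup (Fin n) ℂ) :
    ‖((uGL k : GL (Fin n) ℂ) : Matrix (Fin n) (Fin n) ℂ).det‖ = 1 := by
  have h : ((uGL k : GL (Fin n) ℂ) : Matrix (Fin n) (Fin n) ℂ) = (k : Matrix (Fin n) (Fin n) ℂ) :=
    rfl
  have := Matrix.det_of_mem_unitary k.2
  rw [h]
  exact CStarRing.norm_of_mem_unitary this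

/-- For unitary `k` the two slots produce a power of `det k` and its conjugate, whose product is `1`
since `|det k| = 1`. -/
theorem IsInvariantInner.twist {wt wt' : DomWeight n} {l : ℤ} (h : ∀ i, wt' i = wt i - l)
    {B : Vrep wt →ₗ[ℂ] Vrep wt →ₗ⋆[ℂ] ℂ} (hB : IsInvariantInner wt B) :
    IsInvariantInner wt' ((B.comp ((detEquiv wt wt' l h).symm : Vrep wt' →ₗ[ℂ] Vrep wt)).compl₂
      ((detEquiv wt wt' l h).symm : Vrep wt' →ₗ[ℂ] Vrep wt)) where
  hermitian v v' := hB.hermitian _ _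
  positive v hv := hB.positive _ (by simpa using hv)
  invariant k v v' := by
    have hn : ‖((uGL k : GL (Fin n) ℂ) : Matrix (Fin n) (Fin n) ℂ).det ^ l‖ = 1 := by
      rw [norm_zpow, norm_det_uGL, _root_.one_zpow]
    simp only [LinearMap.compl₂_apply, LinearMap.comp_apply, LinearEquiv.coe_coe, detEquiv_symm]
    have hk : ∀ u : Vrep wt', detEquiv wt' wt (-l) (eq_sub_neg h) (tau wt' (uGL k) u)
        = (((uGL k : GL (Fin n) ℂ) : Matrix (Fin n) (Fin n) ℂ).det ^ (-l)) •
          tau wt (uGL k) (detEquiv wt' wt (-l) (eq_sub_neg h) u) := fun u => by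
      rw [tau_detEquiv, smul_smul, ← zpow_add₀ (det_ne_zero _)]
      simp
    rw [hk, hk, LinearMap.map_smul, LinearMap.smul_apply, LinearMap.map_smulₛₗ, hB.invariant,
      smul_smul, _root_.zpow_neg, Complex.mul_conj, Complex.normSq_eq_norm_sq, norm_inv, hn]
    simp
  normalised := by
    simp only [LinearMap.compl₂_apply, LinearMap.comp_apply, LinearEquiv.coe_coe]
    rw [← detEquiv_highestVec h, LinearEquiv.symm_apply_apply, hB.normalised]

theorem invInner_twist {wt wt' : DomWeight n} {l : ℤ} (h : ∀ i, wt' i = wt i - l) :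
    invInner wt' = ((invInner wt).comp
      ((detEquiv wt wt' l h).symm : Vrep wt' →ₗ[ℂ] Vrep wt)).compl₂
      ((detEquiv wt wt' l h).symm : Vrep wt' →ₗ[ℂ] Vrep wt) := by
  exact theUnique_transport (P := IsInvariantInner wt) (Q := IsInvariantInner wt')
    (fun B => (B.comp ((detEquiv wt wt' l h).symm : Vrep wt' →ₗ[ℂ] Vrep wt)).compl₂
      ((detEquiv wt wt' l h).symm : Vrep wt' →ₗ[ℂ] Vrep wt))
    (fun B => (B.comp (detEquiv wt wt' l h : Vrep wt →ₗ[ℂ] Vrep wt')).compl₂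
      (detEquiv wt wt' l h : Vrep wt →ₗ[ℂ] Vrep wt')) 
    (fun B => LinearMap.ext fun v => LinearMap.ext fun v' => by simp)
    (fun B => LinearMap.ext fun v => LinearMap.ext fun v' => by simp)
    (LinearMap.ext fun v => LinearMap.ext fun v' => by simp) (fun B hB => hB.twist h)
    (fun B hB => by
      have := hB.twist (eq_sub_neg h)
      rwa [detEquiv_neg_symm] at this)

theorem invInner_detEquiv {wt wt' : DomWeight n} {l : ℤ} (h : ∀ i, wt' i = wt i - l)
    (v v' : Vrep wt) :
    invInner wt' (detEquiv wt wt' l h v) (detEquiv wt wt' l h v') = invInner wt v v' := by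
  rw [invInner_twist h]
  simp

/-! ### Shifted triangular arrays -/

/-- The array with `c` added to all the entries with `1 ≤ i ≤ j ≤ n`. -/
def shiftArr (n : ℕ) (c : ℤ) (M : TriArray) : TriArray := fun i j =>
  M i j + if 1 ≤ i ∧ i ≤ j ∧ j ≤ n then c else 0

theorem shiftArr_of_mem {c : ℤ} {M : TriArray} {i j : ℕ} (h : 1 ≤ i ∧ i ≤ j ∧ j ≤ n) :
    shiftArr n c M i j = M i j + c := by simp [shiftArr, h]

theorem shiftArr_of_not_mem {c : ℤ} {M : TriArray} {i j : ℕ} (h : ¬ (1 ≤ i ∧ i ≤ j ∧ j ≤ n)) :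
    shiftArr n c M i j = M i j := by simp only [shiftArr, if_neg h, add_zero]

theorem shiftArr_shiftArr_neg (c : ℤ) (M : TriArray) : shiftArr n c (shiftArr n (-c) M) = M := by
  funext i j
  simp only [shiftArr]
  split_ifs <;> ring

theorem shiftArr_neg_shiftArr (c : ℤ) (M : TriArray) : shiftArr n (-c) (shiftArr n c M) = M := by
  funext i j
  simp only [shiftArr]
  split_ifs <;> ring

theorem shiftArr_injective (c : ℤ) : Function.Injective (shiftArr n c) := fun M M' hM => by
  rw [← shiftArr_neg_shiftArr (n := n) c M, hM, shiftArr_neg_shiftArr]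

theorem shiftArr_addAt (c e : ℤ) (M : TriArray) (i j : ℕ) :
    shiftArr n c (addAt M i j e) = addAt (shiftArr n c M) i j e := by
  funext i' j'
  simp only [shiftArr, addAt]
  ring

theorem shiftArr_dualArray (c : ℤ) (M : TriArray) :
    shiftArr n (-c) (dualArray M) = dualArray (shiftArr n c M) := by
  funext i j
  -- The reflection `i ↦ j + 1 - i` preserves the triangle, even with truncated subtraction, so the
  -- shift hits the same cells before and after dualising.
  have : (1 ≤ j + 1 - i ∧ j + 1 - i ≤ j ∧ j ≤ n) ↔ (1 ≤ i ∧ i ≤ j ∧ j ≤ n) := by omega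
  simp only [shiftArr, dualArray, this]
  split_ifs <;> ring

theorem shiftArr_highestPattern {wt wt' : DomWeight n} {l : ℤ} (h : ∀ i, wt' i = wt i - l) :
    shiftArr n l (highestPattern wt') = highestPattern wt := by
  funext i j
  by_cases hij : 1 ≤ i ∧ i ≤ j ∧ j ≤ n
  · rw [shiftArr_of_mem hij]
    simp only [highestPattern, if_pos hij, DomWeight.entry_of_sub h hij.1 (hij.2.1.trans hij.2.2)]
    ring
  · rw [shiftArr_of_not_mem hij]
    simp only [highestPattern, if_neg hij]

theorem shiftArr_mem {wt wt' : DomWeight n} {l : ℤ} (h : ∀ i, wt' i = wt i - l) {M : TriArray}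
    (hM : M ∈ gtPatterns wt') : shiftArr n l M ∈ gtPatterns wt := by
  obtain ⟨h0, h1, h2⟩ := hM
  refine ⟨fun i j hij => ?_, fun i hi hin => ?_, fun i j hi hij hj => ?_⟩
  · rw [shiftArr_of_not_mem hij, h0 i j hij]
  · rw [shiftArr_of_mem ⟨hi, hin, le_rfl⟩, h1 i hi hin, DomWeight.entry_of_sub h hi hin]
    ring
  · rw [shiftArr_of_mem ⟨hi, hij, hj.le⟩, shiftArr_of_mem ⟨hi, by omega, hj⟩,
      shiftArr_of_mem ⟨by omega, by omega, hj⟩]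
    obtain ⟨h3, h4⟩ := h2 i j hi hij hj
    exact ⟨by linarith, by linarith⟩

theorem shiftArr_mem_iff {wt wt' : DomWeight n} {l : ℤ} (h : ∀ i, wt' i = wt i - l)
    {M : TriArray} : shiftArr n l M ∈ gtPatterns wt ↔ M ∈ gtPatterns wt' :=
  ⟨fun hM => by
    rw [← shiftArr_neg_shiftArr (n := n) l M]
    exact shiftArr_mem (eq_sub_neg h) hM, shiftArr_mem h⟩

/-- Row `k` gains `k c` and row `k - 1` gains `(k - 1) c`. -/
theorem patternWeight_shiftArr (c : ℤ) (M : TriArray) {k : ℕ} (hk : 1 ≤ k) (hkn : k ≤ n) :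
    patternWeight (shiftArr n c M) k = patternWeight M k + c := by
  have hs : ∀ j ≤ n, ∑ i ∈ Finset.Icc 1 j, shiftArr n c M i j
      = ∑ i ∈ Finset.Icc 1 j, M i j + j * c := fun j hj => by
    rw [Finset.sum_congr rfl fun i hi => shiftArr_of_mem (M := M) (c := c)
      ⟨(Finset.mem_Icc.mp hi).1, (Finset.mem_Icc.mp hi).2, hj⟩, Finset.sum_add_distrib]
    simp
  rw [patternWeight, patternWeight, hs k hkn, hs (k - 1) (by omega)]
  push_cast [Nat.cast_sub hk]
  ring

/-- The coefficient involves only differences of entries; the bounds on `i` and `j` keep all of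
these entries inside the triangle, where the shift acts uniformly. -/
theorem gtCoeff_shiftArr (c : ℤ) (M : TriArray) {i j : ℕ} (hi : 1 ≤ i) (hij : i ≤ j)
    (hj : j < n) : gtCoeff i j (shiftArr n c M) = gtCoeff i j M := by
  have h1 : ∏ h ∈ Finset.Icc 1 (j + 1),
      ((shiftArr n c M h (j + 1) - shiftArr n c M i j - h + i : ℤ) : ℝ)
      = ∏ h ∈ Finset.Icc 1 (j + 1), ((M h (j + 1) - M i j - h + i : ℤ) : ℝ) := by
    refine Finset.prod_congr rfl fun h hh => ?_
    obtain ⟨ha, hb⟩ := Finset.mem_Icc.mp hh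
    rw [shiftArr_of_mem ⟨ha, hb, hj⟩, shiftArr_of_mem ⟨hi, hij, hj.le⟩]
    congr 1; ring
  have h2 : ∏ h ∈ Finset.Icc 1 (j - 1),
      ((shiftArr n c M h (j - 1) - shiftArr n c M i j - h + i - 1 : ℤ) : ℝ)
      = ∏ h ∈ Finset.Icc 1 (j - 1), ((M h (j - 1) - M i j - h + i - 1 : ℤ) : ℝ) := by
    refine Finset.prod_congr rfl fun h hh => ?_
    obtain ⟨ha, hb⟩ := Finset.mem_Icc.mp hh
    rw [shiftArr_of_mem ⟨ha, hb, by omega⟩, shiftArr_of_mem ⟨hi, hij, hj.le⟩]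
    congr 1; ring
  have h3 : ∏ h ∈ (Finset.Icc 1 j).erase i,
      (((shiftArr n c M h j - shiftArr n c M i j - h + i : ℤ) : ℝ) *
        ((shiftArr n c M h j - shiftArr n c M i j - h + i - 1 : ℤ) : ℝ))
      = ∏ h ∈ (Finset.Icc 1 j).erase i,
      (((M h j - M i j - h + i : ℤ) : ℝ) * ((M h j - M i j - h + i - 1 : ℤ) : ℝ)) := by
    refine Finset.prod_congr rfl fun h hh => ?_
    obtain ⟨ha, hb⟩ := Finset.mem_Icc.mp (Finset.mem_of_mem_erase hh)
    rw [shiftArr_of_mem ⟨ha, hb, hj.le⟩, shiftArr_of_mem ⟨hi, hij, hj.le⟩]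
    congr 2 <;> ring
  rw [gtCoeff, gtCoeff, h1, h2, h3]

theorem rConst_shiftArr (c : ℤ) (M : TriArray) : rConst n (shiftArr n c M) = rConst n M := by
  refine Finset.prod_congr rfl fun k hk => Finset.prod_congr rfl fun j hj =>
    Finset.prod_congr rfl fun i hi => ?_
  rw [Finset.mem_Icc] at hk hj hi
  rw [shiftArr_of_mem (i := i) (j := k) (by omega), shiftArr_of_mem (i := j) (j := k - 1) (by omega),
    shiftArr_of_mem (i := i) (j := k - 1) (by omega),
    shiftArr_of_mem (i := j + 1) (j := k) (by omega)]
  congr 3 <;> ring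

theorem sum_Icc_card (n : ℕ) : ∑ j ∈ Finset.Icc 1 (n - 1), (j : ℤ) = bDeg n := by
  have h : ∑ j ∈ Finset.Icc 1 (n - 1), j = ∑ j ∈ Finset.range n, j := by
    symm
    rcases Nat.eq_zero_or_pos n with rfl | hn
    · simp
    · obtain ⟨m, rfl⟩ := Nat.exists_eq_add_of_le' hn
      rw [Finset.sum_range_succ', Nat.add_sub_cancel, add_zero]
      rw [Finset.range_eq_Ico, Finset.sum_Ico_add' (fun i => i) 0 m 1]
      rfl
  rw [bDeg, ← Finset.sum_range_id, ← h]
  push_cast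
  rfl

/-- There are `b_n` entries below the top row. This is the source of the signs in the conjugation
map and in the invariant element. -/
theorem qInv_shiftArr (c : ℤ) (M : TriArray) :
    qInv n (shiftArr n c M) = qInv n M + bDeg n * c := by
  rw [qInv, qInv, ← sum_Icc_card, Finset.sum_mul, ← Finset.sum_add_distrib]
  refine Finset.sum_congr rfl fun j hj => ?_
  rw [Finset.mem_Icc] at hj
  rw [Finset.sum_congr rfl fun i hi => shiftArr_of_mem (M := M) (c := c)
      ⟨(Finset.mem_Icc.mp hi).1, (Finset.mem_Icc.mp hi).2, by omega⟩, Finset.sum_add_distrib]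
  simp

/-! ### Infinitesimal action and the determinant -/

theorem coe_expGL (X : Matrix (Fin n) (Fin n) ℂ) :
    (expGL X : Matrix (Fin n) (Fin n) ℂ) = NormedSpace.exp X := rfl

theorem expGL_zero : expGL (0 : Matrix (Fin n) (Fin n) ℂ) = 1 := by
  ext i j
  rw [coe_expGL, NormedSpace.exp_zero]; rfl

theorem hasDerivAt_expGL_apply (X : Matrix (Fin n) (Fin n) ℂ) (i j : Fin n) :
    HasDerivAt (fun t : ℝ => (expGL ((t : ℂ) • X) : Matrix (Fin n) (Fin n) ℂ) i j) (X i j) 0 := by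
  -- A norm is chosen only to differentiate the exponential; the claim about entries does not depend
  -- on it.
  let _ : NormedRing (Matrix (Fin n) (Fin n) ℂ) := Matrix.linftyOpNormedRing
  let _ : NormedAlgebra ℂ (Matrix (Fin n) (Fin n) ℂ) := Matrix.linftyOpNormedAlgebra
  have h1 := hasDerivAt_exp_smul_const (𝕂 := ℂ) X 0
  rw [zero_smul, NormedSpace.exp_zero, one_mul] at h1
  have h2 := (LinearMap.toContinuousLinearMap
    (Matrix.entryLinearMap ℂ ℂ i j)).hasFDerivAt.comp_hasDerivAt (0 : ℂ) h1
  have h3 := HasDerivAt.comp_ofReal (z := 0) (by simpa using! h2)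
  with_unfolding_all exact h3

/-- In the Leibniz expansion at the identity, a nontrivial permutation moves at least two indices.
Differentiating one factor leaves another off-diagonal factor, which vanishes, so only the diagonal
product contributes. -/
theorem hasDerivAt_det_expGL (X : Matrix (Fin n) (Fin n) ℂ) :
    HasDerivAt (fun t : ℝ => (expGL ((t : ℂ) • X) : Matrix (Fin n) (Fin n) ℂ).det) X.trace 0 := by
  simp only [Matrix.det_apply']
  have h0 : ∀ i j, ((expGL (((0 : ℝ) : ℂ) • X) : GL (Fin n) ℂ) : Matrix (Fin n) (Fin n) ℂ) i j
      = if i = j then 1 else 0 := fun i j => by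
    rw [Complex.ofReal_zero, zero_smul, expGL_zero]; exact Matrix.one_apply
  have h1 : ∀ σ : Equiv.Perm (Fin n), HasDerivAt
      (fun t : ℝ => (((Equiv.Perm.sign σ : ℤˣ) : ℤ) : ℂ) *
        ∏ i, (expGL ((t : ℂ) • X) : Matrix (Fin n) (Fin n) ℂ) (σ i) i)
      (if σ = 1 then X.trace else 0) 0 := fun σ => by
    have h2 := (HasDerivAt.fun_finsetProd (u := Finset.univ)
      fun i _ => hasDerivAt_expGL_apply X (σ i) i).const_mul (((Equiv.Perm.sign σ : ℤˣ) : ℤ) : ℂ)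
    refine h2.congr_deriv ?_
    simp only [h0]
    symm
    split_ifs with hσ
    · subst hσ
      simp [Matrix.trace]
    · rw [Finset.sum_eq_zero, mul_zero]
      intro i _
      -- A permutation fixing every index other than `i` also fixes `i`, by injectivity; so `σ ≠ 1`
      -- moves some `j ≠ i`.
      obtain ⟨j, hj, hji⟩ : ∃ j, σ j ≠ j ∧ j ≠ i := by
        by_contra! hcon
        apply hσ
        have hfix : ∀ j, j ≠ i → σ j = j := fun j hj => by
          by_contra h'
          exact hj (hcon j h')
        ext1 j
        by_cases hj : j = i
        · subst hj
          by_contra h'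
          have := hfix (σ j) h'
          exact h' (σ.injective this)
        · exact hfix j hj
      rw [Finset.prod_eq_zero (i := j) (by simp [hji]) (if_neg hj), zero_smul]
  have h3 := HasDerivAt.fun_sum (u := Finset.univ) fun σ _ => h1 σ
  simpa using h3

theorem differentiableAt_det_submatrix (X : Matrix (Fin n) (Fin n) ℂ) (z : GL (Fin n) ℂ) {k : ℕ}
    (r c : Fin k → Fin n) :
    DifferentiableAt ℝ (fun t : ℝ => (((z * expGL ((t : ℂ) • X) : GL (Fin n) ℂ) :
      Matrix (Fin n) (Fin n) ℂ).submatrix r c).det) 0 := by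
  simp only [Matrix.det_apply', Matrix.submatrix_apply, Units.val_mul, Matrix.mul_apply]
  refine DifferentiableAt.fun_sum fun σ _ => DifferentiableAt.const_mul
    (DifferentiableAt.fun_finsetProd fun i _ => DifferentiableAt.fun_sum fun j _ =>
      DifferentiableAt.const_mul (hasDerivAt_expGL_apply X _ _).differentiableAt _) _

theorem hasDerivAt_det_zpow (X : Matrix (Fin n) (Fin n) ℂ) (z : GL (Fin n) ℂ) (l : ℤ) :
    HasDerivAt (fun t : ℝ => ((z * expGL ((t : ℂ) • X) : GL (Fin n) ℂ) :
      Matrix (Fin n) (Fin n) ℂ).det ^ l)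
      ((z : Matrix (Fin n) (Fin n) ℂ).det ^ l * (l * X.trace)) 0 := by
  simp only [Units.val_mul, Matrix.det_mul, mul_zpow]
  have h0 : ((expGL (((0 : ℝ) : ℂ) • X) : GL (Fin n) ℂ) : Matrix (Fin n) (Fin n) ℂ).det = 1 := by
    rw [Complex.ofReal_zero, zero_smul, expGL_zero]; simp
  have h1 := hasDerivAt_zpow l (1 : ℂ) (Or.inl one_ne_zero)
  have h2 := HasDerivAt.comp_of_eq (0 : ℝ) h1 (hasDerivAt_det_expGL X) h0.symm
  simpa using h2.const_mul ((z : Matrix (Fin n) (Fin n) ℂ).det ^ l)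

/-- `lieAction` is defined by `deriv`, which is `0` at points of non-differentiability, so this must
be known before the product rule can be used. -/
theorem differentiableAt_Vrep {wt : DomWeight n} {f : GL (Fin n) ℂ → ℂ} (hf : f ∈ Vrep wt)
    (X : Matrix (Fin n) (Fin n) ℂ) (z : GL (Fin n) ℂ) :
    DifferentiableAt ℝ (fun t : ℝ => f (z * expGL ((t : ℂ) • X))) 0 := by
  induction hf using Submodule.span_induction with
  | zero => exact differentiableAt_const _
  | add x y _ _ hx hy => exact hx.add hy
  | smul a x _ hx => exact hx.const_mul a
  | mem x hx =>
    obtain ⟨e, -, rfl⟩ := hx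
    exact (hasDerivAt_det_zpow X z _).differentiableAt.mul
      (DifferentiableAt.fun_finsetProd fun I _ =>
        (differentiableAt_det_submatrix X z _ _).fun_pow _)

/-- Leibniz rule, with `det^{-l}` having logarithmic derivative `-l tr X`. Diagonal units have trace
`1`, so weights drop by `l`; off-diagonal units have trace `0`, so raising and lowering are
unaffected. -/
theorem lieAction_detEquiv {wt wt' : DomWeight n} {l : ℤ} (h : ∀ i, wt' i = wt i - l)
    (X : Matrix (Fin n) (Fin n) ℂ) (v : Vrep wt) :
    lieAction X (detEquiv wt wt' l h v : GL (Fin n) ℂ → ℂ)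
      = (fun g : GL (Fin n) ℂ => (g : Matrix (Fin n) (Fin n) ℂ).det ^ (-l)) *
        (lieAction X (v : GL (Fin n) ℂ → ℂ) - (l * X.trace) • (v : GL (Fin n) ℂ → ℂ)) := by
  funext z
  have h1 := (hasDerivAt_det_zpow X z (-l)).mul (differentiableAt_Vrep v.2 X z).hasDerivAt
  have h2 : lieAction X (detEquiv wt wt' l h v : GL (Fin n) ℂ → ℂ) z = _ := h1.deriv
  rw [h2]
  simp only [Complex.ofReal_zero, zero_smul, expGL_zero, mul_one, Pi.mul_apply, Pi.sub_apply,
    Pi.smul_apply, smul_eq_mul, lieAction]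
  push_cast
  ring

theorem trace_matUnit_self {k : ℕ} (hk : 1 ≤ k) (hkn : k ≤ n) : (matUnit n k k).trace = 1 := by
  rw [Matrix.trace, Finset.sum_eq_single (⟨k - 1, by omega⟩ : Fin n)]
  · simp only [matUnit, Matrix.diag_apply, Matrix.of_apply]
    rw [if_pos (by omega)]
  · intro b _ hb
    simp only [matUnit, Matrix.diag_apply, Matrix.of_apply]
    rw [if_neg]
    rintro ⟨h1, -⟩
    exact hb (Fin.ext (by simp only; omega))
  · intro h; exact absurd (Finset.mem_univ _) h

theorem trace_matUnit_of_ne {i j : ℕ} (hij : i ≠ j) : (matUnit n i j).trace = 0 := by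
  refine Finset.sum_eq_zero fun b _ => ?_
  simp only [matUnit, Matrix.diag_apply, Matrix.of_apply]
  rw [if_neg (by omega)]

/-! ### The Gel'fand–Tsetlin basis -/

theorem coe_detEquiv {wt wt' : DomWeight n} {l : ℤ} (h : ∀ i, wt' i = wt i - l) (v : Vrep wt) :
    (detEquiv wt wt' l h v : GL (Fin n) ℂ → ℂ)
      = (fun g : GL (Fin n) ℂ => (g : Matrix (Fin n) (Fin n) ℂ).det ^ (-l)) *
        (v : GL (Fin n) ℂ → ℂ) := rfl

/-- A pattern of type `λ - l` becomes one of type `λ` after adding `l` to every entry. The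
coefficients see only differences, and the increase of the pattern weight by `l` cancels the trace
term. -/
theorem IsGTBasis.twist {wt wt' : DomWeight n} {l : ℤ} (h : ∀ i, wt' i = wt i - l)
    {ζ : TriArray → Vrep wt} (hζ : IsGTBasis wt ζ) :
    IsGTBasis wt' (fun M => detEquiv wt wt' l h (ζ (shiftArr n l M))) where
  off M hM := by
    rw [hζ.off _ fun hM' => hM ((shiftArr_mem_iff h).mp hM'), map_zero]
  orthonormal M hM M' hM' := by
    rw [invInner_detEquiv, hζ.orthonormal _ (shiftArr_mem h hM) _ (shiftArr_mem h hM')]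
    by_cases hMM : M = M'
    · rw [if_pos hMM, if_pos (congrArg _ hMM)]
    · rw [if_neg hMM, if_neg fun e => hMM (shiftArr_injective l e)]
  spans := by
    have : (fun M => detEquiv wt wt' l h (ζ (shiftArr n l M))) '' gtPatterns wt'
        = (detEquiv wt wt' l h : Vrep wt →ₗ[ℂ] Vrep wt') '' (ζ '' gtPatterns wt) := by
      ext v
      constructor
      · rintro ⟨M, hM, rfl⟩
        exact ⟨_, ⟨_, shiftArr_mem h hM, rfl⟩, rfl⟩
      · rintro ⟨_, ⟨M, hM, rfl⟩, rfl⟩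
        refine ⟨shiftArr n (-l) M, shiftArr_mem (eq_sub_neg h) hM, ?_⟩
        change detEquiv wt wt' l h (ζ (shiftArr n l (shiftArr n (-l) M))) = _
        rw [shiftArr_shiftArr_neg]
        rfl
    rw [this, Submodule.span_image, hζ.spans, Submodule.map_top, LinearEquiv.range]
  highest := by rw [shiftArr_highestPattern h, hζ.highest, detEquiv_highestVec]
  weight M hM k hk hkn := by
    rw [lieAction_detEquiv, hζ.weight _ (shiftArr_mem h hM) k hk hkn, trace_matUnit_self hk hkn,
      patternWeight_shiftArr l M hk hkn, coe_detEquiv, mul_one, ← sub_smul, mul_smul_comm]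
    congr 2
    push_cast
    ring
  raising M hM j hj hjn := by
    rw [lieAction_detEquiv, hζ.raising _ (shiftArr_mem h hM) j hj hjn,
      trace_matUnit_of_ne (by omega), mul_zero, zero_smul, sub_zero, Finset.mul_sum]
    refine Finset.sum_congr rfl fun i hi => ?_
    obtain ⟨hi1, hi2⟩ := Finset.mem_Icc.mp hi
    rw [gtCoeff_shiftArr l M hi1 hi2 hjn, coe_detEquiv, shiftArr_addAt, mul_smul_comm]
  lowering M hM j hj hjn := by
    rw [lieAction_detEquiv, hζ.lowering _ (shiftArr_mem h hM) j hj hjn,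
      trace_matUnit_of_ne (by omega), mul_zero, zero_smul, sub_zero, Finset.mul_sum]
    refine Finset.sum_congr rfl fun i hi => ?_
    obtain ⟨hi1, hi2⟩ := Finset.mem_Icc.mp hi
    -- Dualising reverses the sign of the shift, and the coefficient is insensitive to either.
    rw [← shiftArr_dualArray, gtCoeff_shiftArr (-l) _ hi1 hi2 hjn, coe_detEquiv, shiftArr_addAt,
      mul_smul_comm]

theorem gtZeta_twist {wt wt' : DomWeight n} {l : ℤ} (h : ∀ i, wt' i = wt i - l) :
    gtZeta wt' = fun M => detEquiv wt wt' l h (gtZeta wt (shiftArr n l M)) := by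
  refine theUnique_transport (P := IsGTBasis wt) (Q := IsGTBasis wt')
    (fun ζ M => detEquiv wt wt' l h (ζ (shiftArr n l M)))
    (fun ζ M => (detEquiv wt wt' l h).symm (ζ (shiftArr n (-l) M))) (fun ζ => ?_) (fun ζ => ?_) ?_
    (fun ζ hζ => hζ.twist h) (fun ζ hζ => ?_)
  · funext M; simp [shiftArr_shiftArr_neg]
  · funext M; simp [shiftArr_neg_shiftArr]
  · funext M; simp
  · simp only [detEquiv_symm]
    exact hζ.twist (eq_sub_neg h)

theorem xi_twist {wt wt' : DomWeight n} {l : ℤ} (h : ∀ i, wt' i = wt i - l) (M : TriArray) :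
    xi wt' M = detEquiv wt wt' l h (xi wt (shiftArr n l M)) := by
  rw [xi, xi, gtZeta_twist h, rConst_shiftArr, map_smul]

/-! ### The conjugation map -/

theorem neg_one_zpow_mul_self (k : ℤ) : ((-1 : ℂ) ^ k) * (-1) ^ k = 1 := by
  rw [← mul_zpow]; simp

/-- `M ↦ M^∨` negates entries, so source and target twist oppositely, and the change of `q(M)` costs
`(-1)^{b_n l}`. Only values on the `ξ_M` are compared, so it does not matter whether they form a
basis. -/
theorem conjIso_twist_property {wt wt' wt₂ wt₂' : DomWeight n} {l l' : ℤ}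
    (h : ∀ i, wt₂ i = wt i - l) (h' : ∀ i, wt₂' i = wt' i - l') (hl : l' = -l)
    (T : Vrep wt →ₗ[ℂ] Vconj wt')
    (hT : ∀ M ∈ gtPatterns wt, T (xi wt M) = ((-1 : ℂ) ^ qInv n M) • xi wt' (dualArray M)) :
    ∀ M ∈ gtPatterns wt₂, ((-1 : ℂ) ^ (bDeg n * l)) • detEquiv wt' wt₂' l' h'
      (T ((detEquiv wt wt₂ l h).symm (xi wt₂ M)))
        = ((-1 : ℂ) ^ qInv n M) • xi wt₂' (dualArray M) := fun M hM => by
  subst hl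
  rw [xi_twist h M, LinearEquiv.symm_apply_apply, hT _ (shiftArr_mem h hM), xi_twist h',
    shiftArr_dualArray, map_smul, qInv_shiftArr, smul_smul, zpow_add₀ (by norm_num),
    mul_comm, mul_assoc, neg_one_zpow_mul_self, mul_one]

theorem conjIso_twist {wt wt' wt₂ wt₂' : DomWeight n} {l l' : ℤ}
    (h : ∀ i, wt₂ i = wt i - l) (h' : ∀ i, wt₂' i = wt' i - l') (hl : l' = -l)
    (hc : wt' = wt.dual) (hc' : wt₂' = wt₂.dual) :
    conjIso wt₂ wt₂' hc' ∘ₗ (detEquiv wt wt₂ l h : Vrep wt →ₗ[ℂ] Vrep wt₂)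
      = ((-1 : ℂ) ^ (bDeg n * l)) •
        ((detEquiv wt' wt₂' l' h' : Vrep wt' →ₗ[ℂ] Vrep wt₂') ∘ₗ conjIso wt wt' hc) := by
  have key : conjIso wt₂ wt₂' hc' = ((-1 : ℂ) ^ (bDeg n * l)) •
      ((detEquiv wt' wt₂' l' h' : Vrep wt' →ₗ[ℂ] Vrep wt₂') ∘ₗ conjIso wt wt' hc ∘ₗ
        ((detEquiv wt wt₂ l h).symm : Vrep wt₂ →ₗ[ℂ] Vrep wt)) := by
    -- The sign is its own inverse, so the backward transport, which produces exponent `-l`, carries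
    -- the same prefactor.
    have hs : (-1 : ℂ) ^ (bDeg n * -l) = (-1 : ℂ) ^ (bDeg n * l) := by
      rw [mul_neg, _root_.zpow_neg, ← _root_.inv_zpow]; norm_num
    refine theUnique_transport
      (fun T : Vrep wt →ₗ[ℂ] Vconj wt' => ((-1 : ℂ) ^ (bDeg n * l)) •
        ((detEquiv wt' wt₂' l' h' : Vrep wt' →ₗ[ℂ] Vrep wt₂') ∘ₗ T ∘ₗ
          ((detEquiv wt wt₂ l h).symm : Vrep wt₂ →ₗ[ℂ] Vrep wt)))
      (fun T : Vrep wt₂ →ₗ[ℂ] Vconj wt₂' => ((-1 : ℂ) ^ (bDeg n * l)) •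
        (((detEquiv wt' wt₂' l' h').symm : Vrep wt₂' →ₗ[ℂ] Vrep wt') ∘ₗ T ∘ₗ
          (detEquiv wt wt₂ l h : Vrep wt →ₗ[ℂ] Vrep wt₂)))
      (fun T => LinearMap.ext fun v => ?_) (fun T => LinearMap.ext fun v => ?_)
      (LinearMap.ext fun v => ?_) (fun T hT => ?_) (fun T hT => ?_)
    · simp [smul_smul, neg_one_zpow_mul_self]
    · simp [smul_smul, neg_one_zpow_mul_self]
    · simp
    · exact conjIso_twist_property h h' hl T hT
    · have := conjIso_twist_property (eq_sub_neg h) (eq_sub_neg h') (by rw [hl]) T hT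
      rw [hs] at this
      rw [detEquiv_neg_symm h, ← detEquiv_symm h'] at this
      exact this
  refine LinearMap.ext fun v => ?_
  rw [key]
  simp

/-! ### Cartan injections -/

/-- The characters `det^{-l₁}` and `det^{-l₂}` of the two factors multiply to `det^{-l}`, the
character of the source, exactly because `l = l₁ + l₂`. Highest weight vectors go to highest weight
vectors, so no scalar appears. -/
theorem IsCartanInjection.twist {wt₁ wt₂ wt wt₁' wt₂' wt' : DomWeight n} {l₁ l₂ l : ℤ}
    (h₁ : ∀ i, wt₁' i = wt₁ i - l₁) (h₂ : ∀ i, wt₂' i = wt₂ i - l₂) (h : ∀ i, wt' i = wt i - l)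
    (hl : l = l₁ + l₂) {T : Vrep wt →ₗ[ℂ] Vrep wt₁ ⊗[ℂ] Vrep wt₂}
    (hT : IsCartanInjection wt₁ wt₂ wt T) :
    IsCartanInjection wt₁' wt₂' wt'
      ((TensorProduct.congr (detEquiv wt₁ wt₁' l₁ h₁) (detEquiv wt₂ wt₂' l₂ h₂) :
        Vrep wt₁ ⊗[ℂ] Vrep wt₂ →ₗ[ℂ] Vrep wt₁' ⊗[ℂ] Vrep wt₂') ∘ₗ T ∘ₗ
        ((detEquiv wt wt' l h).symm : Vrep wt' →ₗ[ℂ] Vrep wt)) where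
  injective := by
    rw [LinearMap.coe_comp, LinearMap.coe_comp]
    exact (LinearEquiv.injective _).comp (hT.injective.comp (LinearEquiv.injective _))
  equivariant g v := by
    obtain ⟨u, rfl⟩ := (detEquiv wt wt' l h).surjective v
    have hmap : ∀ x : Vrep wt₁ ⊗[ℂ] Vrep wt₂,
        TensorProduct.map (tau wt₁' g) (tau wt₂' g)
          (TensorProduct.congr (detEquiv wt₁ wt₁' l₁ h₁) (detEquiv wt₂ wt₂' l₂ h₂) x)
        = ((g : Matrix (Fin n) (Fin n) ℂ).det ^ (-l)) •
          TensorProduct.congr (detEquiv wt₁ wt₁' l₁ h₁) (detEquiv wt₂ wt₂' l₂ h₂)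
            (TensorProduct.map (tau wt₁ g) (tau wt₂ g) x) := fun x => by
      induction x using TensorProduct.induction_on with
      | zero => simp
      | add x y hx hy => simp only [map_add, hx, hy, smul_add]
      | tmul x y =>
        simp only [TensorProduct.congr_tmul, TensorProduct.map_tmul, tau_detEquiv,
          TensorProduct.smul_tmul_smul]
        rw [← zpow_add₀ (det_ne_zero g), hl, neg_add]
    simp only [LinearMap.comp_apply, LinearEquiv.coe_coe, LinearEquiv.symm_apply_apply]
    rw [hmap, tau_detEquiv, map_smul, LinearEquiv.symm_apply_apply, map_smul, map_smul,
      hT.equivariant]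
  highest := by
    simp only [LinearMap.comp_apply, LinearEquiv.coe_coe]
    rw [← detEquiv_highestVec h, LinearEquiv.symm_apply_apply, hT.highest,
      TensorProduct.congr_tmul, detEquiv_highestVec, detEquiv_highestVec]

theorem cartanInj_twist {wt₁ wt₂ wt wt₁' wt₂' wt' : DomWeight n} {l₁ l₂ l : ℤ}
    (h₁ : ∀ i, wt₁' i = wt₁ i - l₁) (h₂ : ∀ i, wt₂' i = wt₂ i - l₂) (h : ∀ i, wt' i = wt i - l)
    (hl : l = l₁ + l₂) (hs : wt = wt₁ + wt₂) (hs' : wt' = wt₁' + wt₂') :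
    cartanInj wt₁' wt₂' wt' hs' ∘ₗ (detEquiv wt wt' l h : Vrep wt →ₗ[ℂ] Vrep wt')
      = TensorProduct.map (detEquiv wt₁ wt₁' l₁ h₁ : Vrep wt₁ →ₗ[ℂ] Vrep wt₁')
          (detEquiv wt₂ wt₂' l₂ h₂ : Vrep wt₂ →ₗ[ℂ] Vrep wt₂') ∘ₗ cartanInj wt₁ wt₂ wt hs := by
  have key : cartanInj wt₁' wt₂' wt' hs' =
      (TensorProduct.congr (detEquiv wt₁ wt₁' l₁ h₁) (detEquiv wt₂ wt₂' l₂ h₂) :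
        Vrep wt₁ ⊗[ℂ] Vrep wt₂ →ₗ[ℂ] Vrep wt₁' ⊗[ℂ] Vrep wt₂') ∘ₗ cartanInj wt₁ wt₂ wt hs ∘ₗ
        ((detEquiv wt wt' l h).symm : Vrep wt' →ₗ[ℂ] Vrep wt) := by
    refine theUnique_transport (P := IsCartanInjection wt₁ wt₂ wt)
      (Q := IsCartanInjection wt₁' wt₂' wt')
      (fun T => (TensorProduct.congr (detEquiv wt₁ wt₁' l₁ h₁) (detEquiv wt₂ wt₂' l₂ h₂) :
        Vrep wt₁ ⊗[ℂ] Vrep wt₂ →ₗ[ℂ] Vrep wt₁' ⊗[ℂ] Vrep wt₂') ∘ₗ T ∘ₗ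
        ((detEquiv wt wt' l h).symm : Vrep wt' →ₗ[ℂ] Vrep wt))
      (fun T => ((TensorProduct.congr (detEquiv wt₁ wt₁' l₁ h₁) (detEquiv wt₂ wt₂' l₂ h₂)).symm :
        Vrep wt₁' ⊗[ℂ] Vrep wt₂' →ₗ[ℂ] Vrep wt₁ ⊗[ℂ] Vrep wt₂) ∘ₗ T ∘ₗ
        (detEquiv wt wt' l h : Vrep wt →ₗ[ℂ] Vrep wt'))
      (fun T => LinearMap.ext fun v => ?_) (fun T => LinearMap.ext fun v => ?_)
      (LinearMap.ext fun v => ?_) (fun T hT => hT.twist h₁ h₂ h hl) (fun T hT => ?_)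
    · simp only [LinearMap.comp_apply, LinearEquiv.coe_coe, LinearEquiv.symm_apply_apply]
    · simp only [LinearMap.comp_apply, LinearEquiv.coe_coe, LinearEquiv.apply_symm_apply]
    · simp
    · have := hT.twist (eq_sub_neg h₁) (eq_sub_neg h₂) (eq_sub_neg h)
        (l := -l) (l₁ := -l₁) (l₂ := -l₂) (by rw [hl]; ring)
      rw [detEquiv_neg_symm, ← detEquiv_symm, ← detEquiv_symm] at this
      exact this
  refine LinearMap.ext fun v => ?_
  rw [key]
  simp only [LinearMap.comp_apply, LinearEquiv.coe_coe, LinearEquiv.symm_apply_apply]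
  rfl

/-! ### The invariant element -/

/-- Reindexing the sum by the shift of patterns leaves `r(M)` and the tensors matched; only the
change of `q(M)` by `b_n l` remains. -/
theorem idElement_twist {d d' : DomWeight n} {l : ℤ} (h : ∀ i, d' i = d i - l)
    (h' : ∀ i, d'.dual i = d.dual i - -l) :
    TensorProduct.map (detEquiv d d' l h : Vrep d →ₗ[ℂ] Vrep d')
        (detEquiv d.dual d'.dual (-l) h' : Vrep d.dual →ₗ[ℂ] Vrep d'.dual) (idElement d)
      = ((-1 : ℂ) ^ (bDeg n * l)) • idElement d' := by
  rw [idElement, idElement, map_sum, Finset.smul_sum]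
  symm
  refine Finset.sum_nbij (shiftArr n l) ?_ (shiftArr_injective l).injOn ?_ ?_
  · intro M hM
    rw [Set.Finite.mem_toFinset] at hM ⊢
    exact shiftArr_mem h hM
  · intro M hM
    rw [Finset.mem_coe, Set.Finite.mem_toFinset] at hM
    refine ⟨shiftArr n (-l) M, ?_, shiftArr_shiftArr_neg l M⟩
    rw [Finset.mem_coe, Set.Finite.mem_toFinset]
    exact shiftArr_mem (eq_sub_neg h) hM
  · intro M _
    rw [map_smul, TensorProduct.map_tmul, LinearEquiv.coe_coe, LinearEquiv.coe_coe, ← xi_twist h,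
      ← shiftArr_dualArray, ← xi_twist h', rConst_shiftArr, qInv_shiftArr, smul_smul,
      zpow_add₀ (by norm_num)]
    congr 1
    ring

/-! ### Twisting principal series by `κ_{a,b} ∘ det` -/

theorem kappa_mul (a b : ℤ) (z z' : ℂ) : kappa a b (z * z') = kappa a b z * kappa a b z' := by
  simp only [kappa, map_mul, mul_zpow]
  ring

theorem kappa_ne_zero (a b : ℤ) {z : ℂ} (hz : z ≠ 0) : kappa a b z ≠ 0 :=
  mul_ne_zero (zpow_ne_zero _ hz) (zpow_ne_zero _ (by simpa using hz))

theorem kappa_neg (a b : ℤ) (z : ℂ) : kappa (-a) (-b) z = (kappa a b z)⁻¹ := by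
  simp only [kappa, _root_.zpow_neg, mul_inv]

theorem kappa_prod {ι : Type*} (s : Finset ι) (a b : ℤ) (z : ι → ℂ) :
    kappa a b (∏ i ∈ s, z i) = ∏ i ∈ s, kappa a b (z i) := by
  simp only [kappa, map_prod, Finset.prod_zpow, Finset.prod_mul_distrib]

/-- From `z̄ = |z|² / z`. In polar form the exponents are `a - b` on the phase and `a + b` on the
modulus, which dictates the shifts of `d` by `a - b` and of `ν` by `(a + b)/2`. -/
theorem kappa_eq_polar (a b : ℤ) {z : ℂ} (hz : z ≠ 0) :
    kappa a b z = (z / (‖z‖ : ℂ)) ^ (a - b) * (‖z‖ : ℂ) ^ (a + b) := by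
  have hn : (‖z‖ : ℂ) ≠ 0 := by simpa using hz
  have hc : (starRingEnd ℂ) z = (‖z‖ : ℂ) ^ 2 / z := by
    rw [eq_div_iff hz, mul_comm, Complex.mul_conj']
  rw [kappa, hc, div_zpow, div_zpow, sq, mul_zpow, zpow_sub₀ hz, zpow_sub₀ hn, zpow_add₀ hn]
  have := zpow_ne_zero a hn
  have := zpow_ne_zero b hn
  have := zpow_ne_zero b hz
  field_simp

theorem torusChar_twist {a b : ℤ} {d d' : Fin n → ℤ} {ν ν' : Fin n → ℂ}
    (hd : ∀ i, d' i = d i + (a - b)) (hν : ∀ i, ν' i = ν i + ((a : ℂ) + b) / 2)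
    (t : Fin n → ℂˣ) :
    torusChar d' (ν' + rho n) t = torusChar d (ν + rho n) t * kappa a b (∏ i, (t i : ℂ)) := by
  rw [kappa_prod, torusChar, torusChar, ← Finset.prod_mul_distrib]
  refine Finset.prod_congr rfl fun i _ => ?_
  have hz : (t i : ℂ) ≠ 0 := (t i).ne_zero
  have hn : (‖(t i : ℂ)‖ : ℂ) ≠ 0 := by simp
  have he : (2 : ℂ) * (ν' + rho n) i = 2 * (ν + rho n) i + ((a + b : ℤ) : ℂ) := by
    simp only [Pi.add_apply, hν]
    push_cast
    ring
  rw [kappa_eq_polar a b hz, he, Complex.cpow_add _ _ hn, Complex.cpow_intCast, hd,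
    zpow_add₀ (div_ne_zero hz hn)]
  ring

theorem contDiffAt_zpow_real (m : ℤ) {z : ℂ} (hz : z ≠ 0) :
    ContDiffAt ℝ ((⊤ : ℕ∞) : WithTop ℕ∞) (fun w : ℂ => w ^ m) z := by
  cases m with
  | ofNat m =>
    simp only [Int.ofNat_eq_natCast, zpow_natCast]
    exact contDiffAt_id.pow m
  | negSucc m =>
    simp only [zpow_negSucc]
    exact (contDiffAt_id.pow (m + 1)).inv (pow_ne_zero _ hz)

theorem contDiff_det : ContDiff ℝ ((⊤ : ℕ∞) : WithTop ℕ∞)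
    (fun A : Fin n → Fin n → ℂ => (Matrix.of A).det) := by
  simp only [Matrix.det_apply', Matrix.of_apply]
  exact ContDiff.sum fun σ _ => contDiff_const.mul
    (contDiff_prod fun i _ => contDiff_apply_apply ℝ ℂ (σ i) i)

theorem IsSmoothGL.mul_kappa_det (a b : ℤ) {f : GL (Fin n) ℂ → ℂ} (hf : IsSmoothGL f) :
    IsSmoothGL fun g => f g * kappa a b (g : Matrix (Fin n) (Fin n) ℂ).det := by
  have h1 : ContDiffOn ℝ ((⊤ : ℕ∞) : WithTop ℕ∞)
      (fun A : Fin n → Fin n → ℂ => kappa a b (Matrix.of A).det) {A | (Matrix.of A).det ≠ 0} := by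
    intro A hA
    have hA' : (Matrix.of A).det ≠ 0 := hA
    have hd : ContDiffAt ℝ ((⊤ : ℕ∞) : WithTop ℕ∞)
      (fun A : Fin n → Fin n → ℂ => (Matrix.of A).det) A := contDiff_det.contDiffAt
    have hc : ContDiffAt ℝ ((⊤ : ℕ∞) : WithTop ℕ∞)
      (fun A : Fin n → Fin n → ℂ => (starRingEnd ℂ) (Matrix.of A).det) A :=
      Complex.conjCLE.contDiff.contDiffAt.comp A hd
    exact (((contDiffAt_zpow_real a hA').comp A hd).mul
      ((contDiffAt_zpow_real b (by simpa using hA')).comp A hc)).contDiffWithinAt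
  refine (ContDiffOn.mul hf h1).congr fun A hA => ?_
  have hA' : (Matrix.of A).det ≠ 0 := hA
  simp only [zeroExt, dif_pos hA']
  rfl

theorem det_unip_torus (x : StrictUpper n → ℂ) (t : Fin n → ℂˣ) (g : GL (Fin n) ℂ) :
    ((unip x * torus t * g : GL (Fin n) ℂ) : Matrix (Fin n) (Fin n) ℂ).det
      = (∏ i, (t i : ℂ)) * (g : Matrix (Fin n) (Fin n) ℂ).det := by
  have h1 : ((unip x : GL (Fin n) ℂ) : Matrix (Fin n) (Fin n) ℂ).det = 1 := det_unipMatrix x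
  have h2 : ((torus t : GL (Fin n) ℂ) : Matrix (Fin n) (Fin n) ℂ).det = ∏ i, (t i : ℂ) :=
    Matrix.det_diagonal
  rw [Units.val_mul, Units.val_mul, Matrix.det_mul, Matrix.det_mul, h1, h2, one_mul]

/-- `f ↦ f · κ_{a,b}(det)`, from `I^∞(d,ν)` to `I^∞(d+a-b, ν+(a+b)/2)`. -/
def kappaTwist (a b : ℤ) {d d' : Fin n → ℤ} {ν ν' : Fin n → ℂ}
    (hd : ∀ i, d' i = d i + (a - b)) (hν : ∀ i, ν' i = ν i + ((a : ℂ) + b) / 2) :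
    principalSeries d ν →ₗ[ℂ] principalSeries d' ν' where
  toFun f := ⟨fun g => (f : GL (Fin n) ℂ → ℂ) g * kappa a b (g : Matrix (Fin n) (Fin n) ℂ).det,
    f.2.1.mul_kappa_det a b, fun x t g => by
      dsimp only
      rw [f.2.2, det_unip_torus, kappa_mul, torusChar_twist hd hν]
      ring⟩
  map_add' f f' := Subtype.ext (funext fun g => add_mul _ _ _)
  map_smul' c f := Subtype.ext (funext fun g => mul_assoc _ _ _)

theorem kappaTwist_apply (a b : ℤ) {d d' : Fin n → ℤ} {ν ν' : Fin n → ℂ}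
    (hd : ∀ i, d' i = d i + (a - b)) (hν : ∀ i, ν' i = ν i + ((a : ℂ) + b) / 2)
    (f : principalSeries d ν) (g : GL (Fin n) ℂ) :
    (kappaTwist a b hd hν f : GL (Fin n) ℂ → ℂ) g
      = (f : GL (Fin n) ℂ → ℂ) g * kappa a b (g : Matrix (Fin n) (Fin n) ℂ).det := rfl

theorem add_sub_neg {a b : ℤ} {d d' : Fin n → ℤ} (hd : ∀ i, d' i = d i + (a - b)) (i : Fin n) :
    d i = d' i + (-a - -b) := by rw [hd]; ring

theorem add_half_neg {a b : ℤ} {ν ν' : Fin n → ℂ} (hν : ∀ i, ν' i = ν i + ((a : ℂ) + b) / 2)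
    (i : Fin n) : ν i = ν' i + (((-a : ℤ) : ℂ) + ((-b : ℤ) : ℂ)) / 2 := by
  rw [hν]; push_cast; ring

theorem kappaTwist_neg_kappaTwist (a b : ℤ) {d d' : Fin n → ℤ} {ν ν' : Fin n → ℂ}
    (hd : ∀ i, d' i = d i + (a - b)) (hν : ∀ i, ν' i = ν i + ((a : ℂ) + b) / 2)
    (f : principalSeries d ν) :
    kappaTwist (-a) (-b) (add_sub_neg hd) (add_half_neg hν) (kappaTwist a b hd hν f) = f := by
  refine Subtype.ext (funext fun g => ?_)
  rw [kappaTwist_apply, kappaTwist_apply, kappa_neg,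
    mul_inv_cancel_right₀ (kappa_ne_zero a b (det_ne_zero g))]

theorem kappaTwist_kappaTwist_neg (a b : ℤ) {d d' : Fin n → ℤ} {ν ν' : Fin n → ℂ}
    (hd : ∀ i, d' i = d i + (a - b)) (hν : ∀ i, ν' i = ν i + ((a : ℂ) + b) / 2)
    (f : principalSeries d' ν') :
    kappaTwist a b hd hν (kappaTwist (-a) (-b) (add_sub_neg hd) (add_half_neg hν) f) = f := by
  refine Subtype.ext (funext fun g => ?_)
  rw [kappaTwist_apply, kappaTwist_apply, kappa_neg,
    inv_mul_cancel_right₀ (kappa_ne_zero a b (det_ne_zero g))]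

theorem psAction_apply (d : Fin n → ℤ) (ν : Fin n → ℂ) (g z : GL (Fin n) ℂ)
    (f : principalSeries d ν) :
    (psAction d ν g f : GL (Fin n) ℂ → ℂ) z = (f : GL (Fin n) ℂ → ℂ) (z * g) := rfl

theorem psAction_kappaTwist (a b : ℤ) {d d' : Fin n → ℤ} {ν ν' : Fin n → ℂ}
    (hd : ∀ i, d' i = d i + (a - b)) (hν : ∀ i, ν' i = ν i + ((a : ℂ) + b) / 2)
    (g : GL (Fin n) ℂ) (f : principalSeries d ν) :
    psAction d' ν' g (kappaTwist a b hd hν f)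
      = kappa a b (g : Matrix (Fin n) (Fin n) ℂ).det •
        kappaTwist a b hd hν (psAction d ν g f) := by
  refine Subtype.ext (funext fun z => ?_)
  change (psAction d' ν' g (kappaTwist a b hd hν f) : GL (Fin n) ℂ → ℂ) z
    = _ * (kappaTwist a b hd hν (psAction d ν g f) : GL (Fin n) ℂ → ℂ) z
  rw [psAction_apply, kappaTwist_apply, kappaTwist_apply, psAction_apply, Units.val_mul,
    Matrix.det_mul, kappa_mul]
  ring

/-! ### The Jacquet integral -/

/-- On `w_n N_n` the determinant is the constant `det w_n`, so the twist leaves the integral as a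
scalar. No convergence is needed to pull out a constant. -/
theorem jacquetIntegral_mul_kappa_det (ε : ℤˣ) (a b : ℤ) (f : GL (Fin n) ℂ → ℂ) :
    jacquetIntegral ε (fun g => f g * kappa a b (g : Matrix (Fin n) (Fin n) ℂ).det)
      = kappa a b (antidiag n : Matrix (Fin n) (Fin n) ℂ).det * jacquetIntegral ε f := by
  have h : ∀ x : StrictUpper n → ℂ,
      f (antidiag n * unip x) *
        kappa a b ((antidiag n * unip x : GL (Fin n) ℂ) : Matrix (Fin n) (Fin n) ℂ).det *
        psiN (-ε) x
      = kappa a b (antidiag n : Matrix (Fin n) (Fin n) ℂ).det *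
        (f (antidiag n * unip x) * psiN (-ε) x) := fun x => by
    have h1 : ((unip x : GL (Fin n) ℂ) : Matrix (Fin n) (Fin n) ℂ).det = 1 := det_unipMatrix x
    rw [Units.val_mul, Matrix.det_mul, h1, mul_one]
    ring
  rw [jacquetIntegral, jacquetIntegral]
  simp only [h]
  rw [MeasureTheory.integral_const_mul]
  ring

/-- The space `principalSeries d ν` depends on `ν`, and shifted parameters agree only
propositionally; this compares values of `J` through the underlying functions. -/
theorem linearForm_congr {d : Fin n → ℤ} (J : ∀ ν : Fin n → ℂ, principalSeries d ν →ₗ[ℂ] ℂ)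
    {ν ν' : Fin n → ℂ} (hν : ν = ν') {f : principalSeries d ν} {f' : principalSeries d ν'}
    (hf : ∀ g, (f : GL (Fin n) ℂ → ℂ) g = (f' : GL (Fin n) ℂ → ℂ) g) : J ν f = J ν' f' := by
  subst hν
  rw [show f = f' from Subtype.ext (funext hf)]

/-- The transport of a family of linear forms on the `I^∞(d,ν)` to the `I^∞(d+a-b,ν)`. -/
def formTwist (a b : ℤ) {d d' : Fin n → ℤ} (hd : ∀ i, d' i = d i + (a - b))
    (J : ∀ ν : Fin n → ℂ, principalSeries d ν →ₗ[ℂ] ℂ) (ν : Fin n → ℂ) :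
    principalSeries d' ν →ₗ[ℂ] ℂ :=
  kappa a b (antidiag n : Matrix (Fin n) (Fin n) ℂ).det •
    (J (fun i => ν i + (((-a : ℤ) : ℂ) + ((-b : ℤ) : ℂ)) / 2) ∘ₗ
      kappaTwist (-a) (-b) (add_sub_neg hd) fun _ => rfl)

theorem formTwist_apply (a b : ℤ) {d d' : Fin n → ℤ} (hd : ∀ i, d' i = d i + (a - b))
    (J : ∀ ν : Fin n → ℂ, principalSeries d ν →ₗ[ℂ] ℂ) (ν : Fin n → ℂ)
    (f : principalSeries d' ν) :
    formTwist a b hd J ν f = kappa a b (antidiag n : Matrix (Fin n) (Fin n) ℂ).det *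
      J (fun i => ν i + (((-a : ℤ) : ℂ) + ((-b : ℤ) : ℂ)) / 2)
        (kappaTwist (-a) (-b) (add_sub_neg hd) (fun _ => rfl) f) := rfl

theorem formTwist_kappaTwist (a b : ℤ) {d d' : Fin n → ℤ} {ν ν' : Fin n → ℂ}
    (hd : ∀ i, d' i = d i + (a - b)) (hν : ∀ i, ν' i = ν i + ((a : ℂ) + b) / 2)
    (J : ∀ ν : Fin n → ℂ, principalSeries d ν →ₗ[ℂ] ℂ) (f : principalSeries d ν) :
    formTwist a b hd J ν' (kappaTwist a b hd hν f)
      = kappa a b (antidiag n : Matrix (Fin n) (Fin n) ℂ).det * J ν f := by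
  rw [formTwist_apply]
  congr 1
  refine linearForm_congr J (funext fun i => (add_half_neg hν i).symm) fun g => ?_
  rw [kappaTwist_apply, kappaTwist_apply, kappa_neg,
    mul_inv_cancel_right₀ (kappa_ne_zero a b (det_ne_zero g))]

/-- The negated exponents are free variables with equations so that the lemma serves both directions
of the transport, including the one where `- -a` would appear. -/
theorem formTwist_neg_formTwist {a b a' b' : ℤ} (ha : a' = -a) (hb : b' = -b)
    {d d' : Fin n → ℤ} (hd : ∀ i, d' i = d i + (a - b)) (hd' : ∀ i, d i = d' i + (a' - b'))
    (J : ∀ ν : Fin n → ℂ, principalSeries d ν →ₗ[ℂ] ℂ) :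
    formTwist a' b' hd' (formTwist a b hd J) = J := by
  subst ha hb
  funext ν
  refine LinearMap.ext fun f => ?_
  rw [formTwist_apply, formTwist_apply, kappa_neg,
    inv_mul_cancel_left₀ (kappa_ne_zero a b (det_ne_zero _))]
  refine linearForm_congr J (funext fun i => ?_) fun g => ?_
  · push_cast; ring
  · rw [kappaTwist_apply, kappaTwist_apply, kappa_neg, kappa_neg, inv_inv,
      mul_inv_cancel_right₀ (kappa_ne_zero a b (det_ne_zero g))]

/-- Translating all `ν_i` by one scalar preserves the chamber of the integral formula, and the
constant `κ_{a,b}(det w_n)` in `formTwist` cancels the one produced by the integral. Holomorphy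
transfers because `κ_{a,b}(det k)` is independent of `ν`, so twisting sends standard sections to
standard sections. -/
theorem IsJacquetContinuation.twist {ε : ℤˣ} {a b : ℤ} {d d' : Fin n → ℤ}
    (hd : ∀ i, d' i = d i + (a - b)) {J : ∀ ν : Fin n → ℂ, principalSeries d ν →ₗ[ℂ] ℂ}
    (hJ : IsJacquetContinuation ε d J) : IsJacquetContinuation ε d' (formTwist a b hd J) where
  eq_integral ν hν f := by
    rw [formTwist_apply, hJ.eq_integral _ (fun i j hij => by
      simp only [Complex.add_re]
      exact add_lt_add_left (hν i j hij) _)]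
    have h := jacquetIntegral_mul_kappa_det ε (-a) (-b) (f : GL (Fin n) ℂ → ℂ)
    rw [kappa_neg] at h
    rw [eq_inv_mul_iff_mul_eq₀ (kappa_ne_zero a b (det_ne_zero _))] at h
    exact h
  holomorphic F hF := by
    let s : ℂ := ((a : ℂ) + b) / 2
    -- The untwisted section, translated so that its member at `ν - s` comes from `F ν`.
    let F₀ : ∀ ν : Fin n → ℂ, principalSeries d ν := fun ν =>
      kappaTwist (-a) (-b) (add_sub_neg hd) (add_half_neg (ν' := fun i => ν i + s) fun _ => rfl)
        (F fun i => ν i + s)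
    have hF₀ : IsStandardSection d F₀ := fun ν ν' k => by
      simp only [F₀, kappaTwist_apply]
      rw [hF]
    have h1 : Differentiable ℂ fun ν : Fin n → ℂ =>
        (fun i => ν i + (((-a : ℤ) : ℂ) + ((-b : ℤ) : ℂ)) / 2 : Fin n → ℂ) := by fun_prop
    have h2 := ((hJ.holomorphic F₀ hF₀).comp h1).const_mul
      (kappa a b (antidiag n : Matrix (Fin n) (Fin n) ℂ).det)
    convert! h2 using 1
    funext ν
    rw [formTwist_apply]
    congr 1
    refine congrArg _ (Subtype.ext (funext fun g => ?_))
    simp only [F₀, kappaTwist_apply]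
    have e : (fun i => ν i + (((-a : ℤ) : ℂ) + ((-b : ℤ) : ℂ)) / 2 + s) = ν := by
      funext i
      simp only [s]
      push_cast
      ring
    rw [e]

theorem jacquet_twist (ε : ℤˣ) {a b : ℤ} {d d' : Fin n → ℤ} (hd : ∀ i, d' i = d i + (a - b)) :
    jacquet ε d' = formTwist a b hd (jacquet ε d) :=
  theUnique_transport (P := IsJacquetContinuation ε d) (Q := IsJacquetContinuation ε d')
    (formTwist a b hd) (formTwist (-a) (-b) (add_sub_neg hd))
    (fun J => formTwist_neg_formTwist rfl rfl hd _ J)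
    (fun J => formTwist_neg_formTwist (neg_neg a).symm (neg_neg b).symm _ hd J)
    (by funext ν; refine LinearMap.ext fun f => ?_; rw [formTwist_apply]; simp)
    (fun J hJ => hJ.twist hd) (fun J hJ => hJ.twist (add_sub_neg hd))

/-! ### Whittaker functions -/

theorem whittaker_apply (ε : ℤˣ) (d : Fin n → ℤ) (ν : Fin n → ℂ) (f : principalSeries d ν)
    (g : GL (Fin n) ℂ) : whittaker ε d ν f g = jacquet ε d ν (psAction d ν g f) := rfl

/-- One factor of `κ` comes from right translation by `g`, the other from the Jacquet form, which
sees `det w_n`. -/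
theorem whittaker_kappaTwist (ε : ℤˣ) {a b : ℤ} {d d' : Fin n → ℤ} {ν ν' : Fin n → ℂ}
    (hd : ∀ i, d' i = d i + (a - b)) (hν : ∀ i, ν' i = ν i + ((a : ℂ) + b) / 2)
    (f : principalSeries d ν) (g : GL (Fin n) ℂ) :
    whittaker ε d' ν' (kappaTwist a b hd hν f) g
      = kappa a b (antidiag n : Matrix (Fin n) (Fin n) ℂ).det *
        (whittaker ε d ν f g * kappa a b (g : Matrix (Fin n) (Fin n) ℂ).det) := by
  rw [whittaker_apply, whittaker_apply, psAction_kappaTwist, map_smul, jacquet_twist ε hd,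
    formTwist_kappaTwist, smul_eq_mul]
  ring

/-- `W_{κ_{a,b}}`: multiplication of Whittaker functions by `κ_{a,b}(det g)`. -/
def whittakerTwist (ε : ℤˣ) (a b : ℤ) {d d' : Fin n → ℤ} {ν ν' : Fin n → ℂ}
    (hd : ∀ i, d' i = d i + (a - b)) (hν : ∀ i, ν' i = ν i + ((a : ℂ) + b) / 2) :
    WhittakerModel ε d ν →ₗ[ℂ] WhittakerModel ε d' ν' where
  toFun φ := ⟨fun g => (φ : GL (Fin n) ℂ → ℂ) g *
      kappa a b (g : Matrix (Fin n) (Fin n) ℂ).det, by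
    obtain ⟨φ, f, rfl⟩ := φ
    -- The preimage is rescaled to remove the constant `κ_{a,b}(det w_n)` picked up by the Jacquet
    -- form.
    refine ⟨(kappa a b (antidiag n : Matrix (Fin n) (Fin n) ℂ).det)⁻¹ • kappaTwist a b hd hν f,
      funext fun g => ?_⟩
    rw [map_smul, Pi.smul_apply, whittaker_kappaTwist, smul_eq_mul,
      inv_mul_cancel_left₀ (kappa_ne_zero a b (det_ne_zero _))]⟩
  map_add' φ φ' := Subtype.ext (funext fun g => add_mul _ _ _)
  map_smul' c φ := Subtype.ext (funext fun g => mul_assoc _ _ _)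

/-! ### The minimal `U(n)`-type -/

/-- On `U(n)` only `a - b` is visible, so there `κ_{a,b}(det)` agrees with the algebraic twist
`det^{a-b}` of `V_d`. -/
theorem kappa_of_norm_one (a b : ℤ) {z : ℂ} (hz : ‖z‖ = 1) : kappa a b z = z ^ (a - b) := by
  have hz0 : z ≠ 0 := by
    rintro rfl
    simp at hz
  rw [kappa_eq_polar a b hz0, hz]
  simp

/-- The defining property of the embedding of the minimal `U(n)`-type. -/
def IsMinKType (d : DomWeight n) (ν : Fin n → ℂ) (T : Vrep d →ₗ[ℂ] principalSeries d ν) : Prop :=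
  Function.Injective T ∧
    (∀ (k : Matrix.unitaryGroup (Fin n) ℂ) (v : Vrep d),
      T (tau d (uGL k) v) = psAction d ν (uGL k) (T v)) ∧
    (T (highestVec d) : GL (Fin n) ℂ → ℂ) 1 = 1

/-- With `l = b - a` the character `det^{-l}` from `V_d` equals `κ_{a,b}(det)` on `U(n)`, which
gives equivariance. The value at `1` is unchanged since `κ_{a,b}(1) = 1`. -/
theorem IsMinKType.twist {a b l : ℤ} {d d' : DomWeight n} {ν ν' : Fin n → ℂ}
    (hd : ∀ i, d' i = d i + (a - b)) (hν : ∀ i, ν' i = ν i + ((a : ℂ) + b) / 2)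
    (h : ∀ i, d' i = d i - l) (hl : l = b - a) {T : Vrep d →ₗ[ℂ] principalSeries d ν}
    (hT : IsMinKType d ν T) :
    IsMinKType d' ν' (kappaTwist a b hd hν ∘ₗ T ∘ₗ
      ((detEquiv d d' l h).symm : Vrep d' →ₗ[ℂ] Vrep d)) := by
  obtain ⟨hinj, hequiv, hone⟩ := hT
  refine ⟨?_, fun k v => ?_, ?_⟩
  · rw [LinearMap.coe_comp, LinearMap.coe_comp]
    exact (Function.LeftInverse.injective (kappaTwist_neg_kappaTwist a b hd hν)).comp
      (hinj.comp (LinearEquiv.injective _))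
  · obtain ⟨u, rfl⟩ := (detEquiv d d' l h).surjective v
    simp only [LinearMap.comp_apply, LinearEquiv.coe_coe, LinearEquiv.symm_apply_apply]
    rw [tau_detEquiv, map_smul, LinearEquiv.symm_apply_apply, map_smul, map_smul, hequiv,
      psAction_kappaTwist, kappa_of_norm_one a b (norm_det_uGL k), hl, neg_sub]
  · simp only [LinearMap.comp_apply, LinearEquiv.coe_coe]
    rw [← detEquiv_highestVec h, LinearEquiv.symm_apply_apply, kappaTwist_apply, hone]
    simp [kappa]

theorem minKType_twist {a b l : ℤ} {d d' : DomWeight n} {ν ν' : Fin n → ℂ}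
    (hd : ∀ i, d' i = d i + (a - b)) (hν : ∀ i, ν' i = ν i + ((a : ℂ) + b) / 2)
    (h : ∀ i, d' i = d i - l) (hl : l = b - a) (v : Vrep d) :
    minKType d' ν' (detEquiv d d' l h v) = kappaTwist a b hd hν (minKType d ν v) := by
  have key : minKType d' ν' = kappaTwist a b hd hν ∘ₗ minKType d ν ∘ₗ
      ((detEquiv d d' l h).symm : Vrep d' →ₗ[ℂ] Vrep d) := by
    refine theUnique_transport (P := IsMinKType d ν) (Q := IsMinKType d' ν')
      (fun T => kappaTwist a b hd hν ∘ₗ T ∘ₗ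
        ((detEquiv d d' l h).symm : Vrep d' →ₗ[ℂ] Vrep d))
      (fun T => kappaTwist (-a) (-b) (add_sub_neg hd) (add_half_neg hν) ∘ₗ T ∘ₗ
        (detEquiv d d' l h : Vrep d →ₗ[ℂ] Vrep d'))
      (fun T => LinearMap.ext fun v => ?_) (fun T => LinearMap.ext fun v => ?_)
      (LinearMap.ext fun v => ?_) (fun T hT => hT.twist hd hν h hl) (fun T hT => ?_)
    · simp only [LinearMap.comp_apply, LinearEquiv.coe_coe, LinearEquiv.symm_apply_apply,
        kappaTwist_neg_kappaTwist]
    · simp only [LinearMap.comp_apply, LinearEquiv.coe_coe, LinearEquiv.apply_symm_apply,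
        kappaTwist_kappaTwist_neg]
    · simp
    · have := hT.twist (add_sub_neg hd) (add_half_neg hν) (eq_sub_neg h) (by rw [hl]; ring)
      rwa [detEquiv_neg_symm] at this
  rw [key]
  simp only [LinearMap.comp_apply, LinearEquiv.coe_coe, LinearEquiv.symm_apply_apply]

/-! ### Signs -/

theorem sum_fin_val (n : ℕ) : ∑ i : Fin n, ((i : ℕ) : ℤ) = bDeg n := by
  rw [bDeg, ← Finset.sum_range_id, Fin.sum_univ_eq_sum_range (fun i => (i : ℤ)) n]
  push_cast
  rfl

/-- Reversal inverts every one of the `b_n` pairs. -/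
theorem sign_revPerm (n : ℕ) :
    ((Equiv.Perm.sign (Fin.revPerm : Equiv.Perm (Fin n)) : ℤˣ) : ℤ) = (-1) ^ bDeg n := by
  have h : Equiv.Perm.sign (Fin.revPerm : Equiv.Perm (Fin n))
      = ∏ i : Fin n, (-1 : ℤˣ) ^ (n - 1 - (i : ℕ)) := by
    rw [Equiv.Perm.sign_eq_prod_prod_Ioi]
    refine Finset.prod_congr rfl fun i _ => ?_
    rw [Finset.prod_congr rfl fun j hj => if_neg (c := Fin.revPerm i < Fin.revPerm j) (by
      have := Finset.mem_Ioi.mp hj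
      simpa using this.le), Finset.prod_const, Fin.card_Ioi]
  rw [h, Finset.prod_pow_eq_pow_sum, Fin.sum_univ_eq_sum_range (fun i => n - 1 - i) n,
    Finset.sum_range_reflect (fun i => i) n, Finset.sum_range_id]
  simp [bDeg]

theorem det_antidiag (n : ℕ) :
    (antidiag n : Matrix (Fin n) (Fin n) ℂ).det = (-1) ^ bDeg n := by
  have h : (antidiag n : Matrix (Fin n) (Fin n) ℂ)
      = (Fin.revPerm : Equiv.Perm (Fin n)).permMatrix ℂ := by
    ext i j
    change (if j = Fin.rev i then (1 : ℂ) else 0) = _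
    simp [Equiv.Perm.permMatrix, PEquiv.toMatrix_apply, eq_comm]
  rw [h, Matrix.det_permutation, sign_revPerm]
  push_cast
  rfl

/-- `det w_n = ±1` is real, so conjugation is invisible and the exponents add. -/
theorem kappa_det_antidiag (n : ℕ) (a b : ℤ) :
    kappa a b (antidiag n : Matrix (Fin n) (Fin n) ℂ).det = (-1) ^ (bDeg n * (a + b)) := by
  rw [det_antidiag, kappa]
  simp only [map_pow, map_neg, map_one]
  rw [← zpow_add₀ (pow_ne_zero _ (by norm_num)), ← zpow_natCast, ← _root_.zpow_mul]

theorem eps_I_sq (ε : ℤˣ) : (((ε : ℤ) : ℂ) * Complex.I) ^ 2 = -1 := by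
  have h : (((ε : ℤ) : ℂ)) ^ 2 = 1 := by
    rcases Int.units_eq_one_or ε with rfl | rfl <;> simp
  rw [mul_pow, h, Complex.I_sq, one_mul]

/-! ### The normalised Whittaker map -/

theorem gammaFactor_congr {d d' : Fin n → ℤ} {ν ν' : Fin n → ℂ} {c : ℤ} {s : ℂ}
    (hd : ∀ i, d' i = d i + c) (hν : ∀ i, ν' i = ν i + s) : gammaFactor d' ν' = gammaFactor d ν := by
  simp only [gammaFactor, hd, hν, add_sub_add_right_eq_sub]

/-- The map `f ↦ W_ε(f)` onto the Whittaker model. -/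
def whittakerOnto (ε : ℤˣ) (d : Fin n → ℤ) (ν : Fin n → ℂ) :
    principalSeries d ν →ₗ[ℂ] WhittakerModel ε d ν := (whittaker ε d ν).rangeRestrict

theorem whittakerTwist_whittakerOnto (ε : ℤˣ) (a b : ℤ) {d d' : Fin n → ℤ} {ν ν' : Fin n → ℂ}
    (hd : ∀ i, d' i = d i + (a - b)) (hν : ∀ i, ν' i = ν i + ((a : ℂ) + b) / 2)
    (f : principalSeries d ν) :
    whittakerTwist ε a b hd hν (whittakerOnto ε d ν f)
      = (kappa a b (antidiag n : Matrix (Fin n) (Fin n) ℂ).det)⁻¹ •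
        whittakerOnto ε d' ν' (kappaTwist a b hd hν f) := by
  refine Subtype.ext (funext fun g => ?_)
  change whittaker ε d ν f g * _ = _ * whittaker ε d' ν' (kappaTwist a b hd hν f) g
  rw [whittaker_kappaTwist, inv_mul_cancel_left₀ (kappa_ne_zero a b (det_ne_zero _))]

theorem normWhittaker_apply (ε : ℤˣ) (d : DomWeight n) (ν : Fin n → ℂ) (v : Vrep d) :
    normWhittaker ε d ν v = ((-1 : ℂ) ^ (∑ i : Fin n, ((i : ℕ) : ℤ) * d i)
      * (((ε : ℤ) : ℂ) * Complex.I) ^ (∑ i : Fin n, ((i : ℕ) : ℤ) * d i) * gammaFactor d ν) •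
      whittakerOnto ε d ν (minKType d ν v) := rfl

/-- The first scalar undoes `κ_{a,b}(det w_n)`; the other two undo the change of the normalising
powers, as `∑(i-1)d_i` increases by `b_n(a-b)`. The Gamma factor sees only differences. -/
theorem normWhittaker_twist (ε : ℤˣ) {a b l : ℤ} {d d' : DomWeight n} {ν ν' : Fin n → ℂ}
    (hd : ∀ i, d' i = d i + (a - b)) (hν : ∀ i, ν' i = ν i + ((a : ℂ) + b) / 2)
    (h : ∀ i, d' i = d i - l) (hl : l = b - a) :
    whittakerTwist ε a b hd hν ∘ₗ normWhittaker ε d ν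
      = (((-1 : ℂ) ^ (bDeg n * (a + b)))⁻¹ * ((-1 : ℂ) ^ (bDeg n * (a - b)))⁻¹ *
          ((((ε : ℤ) : ℂ) * Complex.I) ^ (bDeg n * (a - b)))⁻¹) •
        (normWhittaker ε d' ν' ∘ₗ (detEquiv d d' l h : Vrep d →ₗ[ℂ] Vrep d')) := by
  have hu : ((ε : ℤ) : ℂ) * Complex.I ≠ 0 := fun h0 => by simpa [h0] using eps_I_sq ε
  have hs : ∑ i : Fin n, ((i : ℕ) : ℤ) * d' i
      = ∑ i : Fin n, ((i : ℕ) : ℤ) * d i + bDeg n * (a - b) := by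
    simp only [hd, mul_add, Finset.sum_add_distrib, ← Finset.sum_mul, sum_fin_val]
  have h1 := zpow_ne_zero (bDeg n * (a - b)) hu
  have h2 := zpow_ne_zero (bDeg n * (a - b)) (show (-1 : ℂ) ≠ 0 by norm_num)
  refine LinearMap.ext fun v => ?_
  rw [LinearMap.smul_apply, LinearMap.comp_apply, LinearMap.comp_apply, LinearEquiv.coe_coe,
    normWhittaker_apply, normWhittaker_apply, minKType_twist hd hν h hl, LinearMap.map_smul,
    whittakerTwist_whittakerOnto, smul_smul, smul_smul, kappa_det_antidiag,
    gammaFactor_congr hd hν, hs, zpow_add₀ hu, zpow_add₀ (show (-1 : ℂ) ≠ 0 by norm_num)]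
  congr 1
  field_simp

/-! ### The twist of the generator -/

/-- Lets the untwisted factor `V_{2ρ_n}` be treated by `cartanInj_twist` with `l₁ = 0`. -/
theorem detEquiv_zero (wt : DomWeight n) (h : ∀ i, wt i = wt i - 0) :
    (detEquiv wt wt 0 h : Vrep wt →ₗ[ℂ] Vrep wt) = LinearMap.id := by
  refine LinearMap.ext fun v => Subtype.ext (funext fun g => ?_)
  change (detEquiv wt wt 0 h v : GL (Fin n) ℂ → ℂ) g = (v : GL (Fin n) ℂ → ℂ) g
  rw [detEquiv_apply]
  simp

/-- Separates the Whittaker factor from the coefficient factor, so that the two can be twisted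
independently. -/
theorem map_comp_map_id_comp {M₁ M₂ M₃ N₁ N₂ N₃ P Q R : Type*} [AddCommMonoid M₁] [AddCommMonoid M₂]
    [AddCommMonoid M₃] [AddCommMonoid N₁] [AddCommMonoid N₂] [AddCommMonoid N₃] [AddCommMonoid P]
    [AddCommMonoid Q] [AddCommMonoid R] [Module ℂ M₁] [Module ℂ M₂] [Module ℂ M₃] [Module ℂ N₁]
    [Module ℂ N₂] [Module ℂ N₃] [Module ℂ P] [Module ℂ Q] [Module ℂ R]
    (f : M₁ →ₗ[ℂ] N₁) (g : M₂ →ₗ[ℂ] N₂) (h : M₃ →ₗ[ℂ] N₃) (c : Q →ₗ[ℂ] P ⊗[ℂ] M₃)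
    (e : R →ₗ[ℂ] M₂ ⊗[ℂ] Q) :
    TensorProduct.map f (TensorProduct.map g (TensorProduct.map LinearMap.id h)) ∘ₗ
        TensorProduct.map LinearMap.id (TensorProduct.map LinearMap.id c) ∘ₗ
        TensorProduct.map LinearMap.id e
      = TensorProduct.map f
          (TensorProduct.map g (TensorProduct.map LinearMap.id h ∘ₗ c) ∘ₗ e) := by
  rw [← TensorProduct.map_comp, ← TensorProduct.map_comp, LinearMap.comp_id,
    LinearMap.comp_id, ← LinearMap.comp_assoc, ← TensorProduct.map_comp, LinearMap.comp_id]

/-- Naturality of `(g ⊗ (id ⊗ h) c) e` in commuting squares. -/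
theorem map_comp_comp_of_squares {M A B C P Q A' B' C' P' Q' N : Type*}
    [AddCommMonoid M] [AddCommMonoid A] [AddCommMonoid B] [AddCommMonoid C] [AddCommMonoid P]
    [AddCommMonoid Q] [AddCommMonoid A'] [AddCommMonoid B'] [AddCommMonoid C']
    [AddCommMonoid P'] [AddCommMonoid Q'] [AddCommMonoid N] [Module ℂ M] [Module ℂ A] [Module ℂ B]
    [Module ℂ C] [Module ℂ P] [Module ℂ Q] [Module ℂ A'] [Module ℂ B'] [Module ℂ C']
    [Module ℂ P'] [Module ℂ Q'] [Module ℂ N] (s : ℂ)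
    {g : M →ₗ[ℂ] N} {h : B →ₗ[ℂ] C} {c : P →ₗ[ℂ] A ⊗[ℂ] B} {e : Q →ₗ[ℂ] M ⊗[ℂ] P}
    {h' : B' →ₗ[ℂ] C'} {c' : P' →ₗ[ℂ] A' ⊗[ℂ] B'} {e' : Q' →ₗ[ℂ] M ⊗[ℂ] P'}
    {α : A →ₗ[ℂ] A'} {β : B →ₗ[ℂ] B'} {γ : C →ₗ[ℂ] C'} {π : P →ₗ[ℂ] P'} {θ : Q →ₗ[ℂ] Q'}
    (h₁ : γ ∘ₗ h = s • (h' ∘ₗ β)) (h₂ : c' ∘ₗ π = TensorProduct.map α β ∘ₗ c)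
    (h₃ : e' ∘ₗ θ = TensorProduct.map LinearMap.id π ∘ₗ e) :
    TensorProduct.map LinearMap.id (TensorProduct.map α γ) ∘ₗ
        (TensorProduct.map g (TensorProduct.map LinearMap.id h ∘ₗ c) ∘ₗ e)
      = s • ((TensorProduct.map g (TensorProduct.map LinearMap.id h' ∘ₗ c') ∘ₗ e') ∘ₗ θ) := by
  have h₄ : TensorProduct.map α γ ∘ₗ TensorProduct.map LinearMap.id h ∘ₗ c
      = s • (TensorProduct.map LinearMap.id h' ∘ₗ c' ∘ₗ π) := by
    rw [h₂, ← LinearMap.comp_assoc, ← LinearMap.comp_assoc, ← TensorProduct.map_comp,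
      ← TensorProduct.map_comp, h₁, TensorProduct.map_smul_right, LinearMap.smul_comp,
      LinearMap.comp_id, LinearMap.id_comp]
  rw [LinearMap.comp_assoc, h₃, ← LinearMap.comp_assoc, ← LinearMap.comp_assoc,
    ← TensorProduct.map_comp, ← TensorProduct.map_comp, h₄, TensorProduct.map_smul_right,
    LinearMap.smul_comp, LinearMap.comp_id, LinearMap.id_comp, LinearMap.comp_assoc]

/-- The factor `V_{d^∨} → ⋀^{b_n} 𝔭^{0∨}_{nℂ} ⊗ V_{λ^∨} ⊗ V^conj_{λ-w}` of `genMap`. -/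
def coeffMap (lam : DomWeight n) (w : ℤ) (d : DomWeight n)
    (hd : ∀ i, d i = 2 * lam i + twoRho n i - w) :
    Vrep d.dual →ₗ[ℂ] (⋀[ℂ]^(bDeg n) (Module.Dual ℂ (pZeroC n))) ⊗[ℂ]
      (Vrep lam.dual ⊗[ℂ] Vconj (lam.shift (-w))) :=
  TensorProduct.map (wedgeHom n)
      (TensorProduct.map LinearMap.id
          (conjIso (lam.dual.shift w) (lam.shift (-w)) (shift_neg_eq_dual lam w)) ∘ₗ
        cartanInj lam.dual (lam.dual.shift w) ((lam.dual + lam.dual).shift w)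
          (two_dual_shift lam w)) ∘ₗ
    cartanInj (twoRho n) ((lam.dual + lam.dual).shift w) d.dual (dual_weight_eq hd)

theorem genMap_eq (ε : ℤˣ) (lam : DomWeight n) (w : ℤ) (d : DomWeight n)
    (hd : ∀ i, d i = 2 * lam i + twoRho n i - w) :
    genMap ε lam w d hd
      = TensorProduct.map (normWhittaker ε d fun _ => (w : ℂ) / 2) (coeffMap lam w d hd) := by
  exact map_comp_map_id_comp (normWhittaker ε d fun _ => (w : ℂ) / 2) (wedgeHom n)
    (conjIso (lam.dual.shift w) (lam.shift (-w)) (shift_neg_eq_dual lam w))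
    (cartanInj lam.dual (lam.dual.shift w) ((lam.dual + lam.dual).shift w) (two_dual_shift lam w))
    (cartanInj (twoRho n) ((lam.dual + lam.dual).shift w) d.dual (dual_weight_eq hd))

theorem cohGenerator_eq (ε : ℤˣ) (lam : DomWeight n) (w : ℤ) (d : DomWeight n)
    (hd : ∀ i, d i = 2 * lam i + twoRho n i - w) :
    cohGenerator ε lam w d hd
      = TensorProduct.map (normWhittaker ε d fun _ => (w : ℂ) / 2) (coeffMap lam w d hd)
        ((((ε : ℤ) : ℂ) * Complex.I) ^ ((bDeg n : ℤ) * w) • idElement d) :=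
  LinearMap.congr_fun (genMap_eq ε lam w d hd) _

/-- `V_{λ^∨}` twists by `a` and `V_{λ^∨+w}` by `-b`, hence their Cartan component and `V_{d^∨}` by
`a - b`. Only the conjugation square contributes a scalar. -/
theorem coeffMap_twist {lam lam' d d' : DomWeight n} {w w' a b l : ℤ}
    (hd : ∀ i, d i = 2 * lam i + twoRho n i - w) (hd' : ∀ i, d' i = 2 * lam' i + twoRho n i - w')
    (ha : ∀ i, lam'.dual i = lam.dual i - a)
    (hb : ∀ i, lam'.shift (-w') i = lam.shift (-w) i - b)
    (hl : ∀ i, d'.dual i = d.dual i - l) (hab : l = a - b)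
    (hc : ∀ i, lam'.dual.shift w' i = lam.dual.shift w i - -b)
    (he : ∀ i, (lam'.dual + lam'.dual).shift w' i = (lam.dual + lam.dual).shift w i - l) :
    TensorProduct.map LinearMap.id
        (TensorProduct.map (detShift lam.dual lam'.dual a ha)
          (detShift (lam.shift (-w)) (lam'.shift (-w')) b hb)) ∘ₗ coeffMap lam w d hd
      = ((-1 : ℂ) ^ (bDeg n * b)) • (coeffMap lam' w' d' hd' ∘ₗ
          (detEquiv d.dual d'.dual l hl : Vrep d.dual →ₗ[ℂ] Vrep d'.dual)) := by
  have h1 := conjIso_twist hc hb (neg_neg b).symm (shift_neg_eq_dual lam w)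
    (shift_neg_eq_dual lam' w')
  have h2 := cartanInj_twist ha hc he (by rw [hab]; ring) (two_dual_shift lam w)
    (two_dual_shift lam' w')
  have h3 := cartanInj_twist (l₁ := 0) (fun i => (sub_zero (twoRho n i)).symm) he hl
    (zero_add l).symm (dual_weight_eq hd) (dual_weight_eq hd')
  have hs : ((-1 : ℂ) ^ (bDeg n * b)) * (-1 : ℂ) ^ (bDeg n * -b) = 1 := by
    rw [← zpow_add₀ (by norm_num), ← mul_add, add_neg_cancel, mul_zero, _root_.zpow_zero]
  have h4 : detShift (lam.shift (-w)) (lam'.shift (-w')) b hb ∘ₗ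
      conjIso (lam.dual.shift w) (lam.shift (-w)) (shift_neg_eq_dual lam w)
      = ((-1 : ℂ) ^ (bDeg n * b)) •
        (conjIso (lam'.dual.shift w') (lam'.shift (-w')) (shift_neg_eq_dual lam' w') ∘ₗ
          (detEquiv _ _ (-b) hc : Vrep (lam.dual.shift w) →ₗ[ℂ] Vrep (lam'.dual.shift w'))) := by
    rw [h1, smul_smul, hs, one_smul]
    rfl
  rw [detEquiv_zero] at h3
  exact map_comp_comp_of_squares ((-1 : ℂ) ^ (bDeg n * b)) (g := wedgeHom n)
    (h := conjIso (lam.dual.shift w) (lam.shift (-w)) (shift_neg_eq_dual lam w))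
    (h' := conjIso (lam'.dual.shift w') (lam'.shift (-w')) (shift_neg_eq_dual lam' w'))
    (γ := detShift (lam.shift (-w)) (lam'.shift (-w')) b hb) h4 h2 h3

theorem map_map_smul_of_squares {M N M' N' A B A' B' : Type*} [AddCommMonoid M] [AddCommMonoid N]
    [AddCommMonoid M'] [AddCommMonoid N'] [AddCommMonoid A] [AddCommMonoid B] [AddCommMonoid A']
    [AddCommMonoid B'] [Module ℂ M] [Module ℂ N] [Module ℂ M'] [Module ℂ N'] [Module ℂ A]
    [Module ℂ B] [Module ℂ A'] [Module ℂ B'] {W : N →ₗ[ℂ] N'} {G : B →ₗ[ℂ] B'} {f : M →ₗ[ℂ] N}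
    {k : A →ₗ[ℂ] B} {f' : M' →ₗ[ℂ] N'} {k' : A' →ₗ[ℂ] B'} {θ : M →ₗ[ℂ] M'} {η : A →ₗ[ℂ] A'}
    {c₁ c₂ c₃ : ℂ} {x : M ⊗[ℂ] A} {x' : M' ⊗[ℂ] A'} (h₁ : W ∘ₗ f = c₁ • (f' ∘ₗ θ))
    (h₂ : G ∘ₗ k = c₂ • (k' ∘ₗ η)) (h₃ : TensorProduct.map θ η x = c₃ • x') {c c' : ℂ}
    (hc : c * (c₁ * c₂ * c₃) = c') :
    TensorProduct.map W G (TensorProduct.map f k (c • x)) = TensorProduct.map f' k' (c' • x') := by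
  rw [map_smul, map_smul, map_smul, ← LinearMap.comp_apply, ← TensorProduct.map_comp, h₁, h₂,
    TensorProduct.map_smul_left, TensorProduct.map_smul_right, TensorProduct.map_comp,
    LinearMap.smul_apply, LinearMap.smul_apply, LinearMap.comp_apply, h₃, map_smul, smul_smul,
    smul_smul, smul_smul, ← hc]
  congr 1
  ring

/-- Writing `-1 = u²` turns the left side into a single power of `u`, with exponent `B(w - 7a +
5b)`. This differs from `B(w + a + b)` by a multiple of `4`, and `u⁴ = 1`. -/
theorem sign_identity {u : ℂ} (hu : u ^ 2 = -1) (B w a b : ℤ) :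
    u ^ (B * w) * ((((-1 : ℂ) ^ (B * (a + b)))⁻¹ * ((-1 : ℂ) ^ (B * (a - b)))⁻¹ *
      (u ^ (B * (a - b)))⁻¹) * (-1 : ℂ) ^ (B * b) * (-1 : ℂ) ^ (B * (b - a)))
      = u ^ (B * (w + a + b)) := by
  have hu0 : u ≠ 0 := by
    rintro rfl
    norm_num at hu
  have h1 : ∀ k : ℤ, (-1 : ℂ) ^ k = u ^ (2 * k) := fun k => by
    rw [_root_.zpow_mul, ← hu]; norm_cast
  have h4 : ∀ k : ℤ, u ^ (4 * k) = 1 := fun k => by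
    have : u ^ (4 : ℤ) = 1 := by
      rw [show (4 : ℤ) = 2 * 2 by norm_num, ← h1]; norm_num
    rw [_root_.zpow_mul, this, _root_.one_zpow]
  simp only [h1, ← _root_.zpow_neg, ← zpow_add₀ hu0]
  -- The correction is `u^{4k} = 1` with `4k = B(-8a + 4b)`, the difference of the two exponents.
  rw [← mul_one (u ^ (B * (w + a + b))), ← h4 (-(2 * B * a) + B * b), ← zpow_add₀ hu0]
  congr 1
  ring

end

end CohGen

theorem proposition2p8 (n : ℕ) (hn : 1 ≤ n) (ε : ℤˣ) (lam d : DomWeight n) (w : ℤ)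
    (hd : ∀ i, d i = 2 * lam i + twoRho n i - w) (a b : ℤ) :
    ∃ W : WhittakerModel ε d (fun _ => (w : ℂ) / 2) →ₗ[ℂ]
        WhittakerModel ε (d.shift (a - b)) (fun _ => ((w + a + b : ℤ) : ℂ) / 2),
      (∀ φ g, (W φ : GL (Fin n) ℂ → ℂ) g = (φ : GL (Fin n) ℂ → ℂ) g *
          kappa a b (g : Matrix (Fin n) (Fin n) ℂ).det) ∧
      TensorProduct.map W (TensorProduct.map LinearMap.id
          (TensorProduct.map
            (detShift lam.dual (lam.shift a).dual a (dual_shift_apply lam a))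
            (detShift (lam.shift (-w)) ((lam.shift a).shift (-(w + a + b))) b
              (shift_shift_apply lam w a b))))
        (cohGenerator ε lam w d hd)
      = cohGenerator ε (lam.shift a) (w + a + b) (d.shift (a - b)) (twisted_weight hd a b) := by
  have hd₁ : ∀ i, d.shift (a - b) i = d i + (a - b) := fun i => rfl
  have hν : ∀ i : Fin n, (fun _ => ((w + a + b : ℤ) : ℂ) / 2 : Fin n → ℂ) i
      = (fun _ => (w : ℂ) / 2 : Fin n → ℂ) i + ((a : ℂ) + b) / 2 := fun i => by
    push_cast
    ring
  -- `detEquiv` lowers weights by `l`, so raising `d` by `a - b` means `l = b - a`, and the dual is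
  -- lowered by `-(b - a)`.
  have hd₂ : ∀ i, d.shift (a - b) i = d i - (b - a) := fun i => by rw [hd₁]; ring
  have hd₃ : ∀ i, (d.shift (a - b)).dual i = d.dual i - -(b - a) := fun i => by
    rw [dual_shift_apply]; ring
  have hW := normWhittaker_twist ε hd₁ hν hd₂ rfl
  have hC := coeffMap_twist hd (twisted_weight hd a b) (dual_shift_apply lam a)
    (shift_shift_apply lam w a b) hd₃ (neg_sub b a)
    (fun i => by simp only [DomWeight.shift, DomWeight.dual]; ring)
    (fun i => by simp only [DomWeight.shift, DomWeight.dual, DomWeight.add_apply]; ring)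
  refine ⟨whittakerTwist ε a b hd₁ hν, fun φ g => rfl, ?_⟩
  rw [cohGenerator_eq ε lam w d hd]
  exact (map_map_smul_of_squares hW hC (idElement_twist hd₂ hd₃)
    (sign_identity (eps_I_sq ε) (bDeg n) w a b)).trans (cohGenerator_eq _ _ _ _ _).symm
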